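/- **Setting.** For $z\in\mathbb R^2$, $r>0$ put $Q_z(r)=z+[-r,r]^2$. Let $V^{(0)}\in L^2_{loc}(\mathbb R^2)$, $V^{(0)}\ge 0$, and let $\omega=(x_i)$ be a countable configuration of points of $\mathbb R^2$ such that $V_\omega(x)=\sum_i V^{(0)}(x-x_i)$ is in $L^2_{loc}(\mathbb R^2)$ (this is assumed to hold for almost every realization of the Poisson process of impurities). For $B>0$ let $$H_{M,\omega}=\tfrac12\Big[\big(-i\nabla-\tfrac B2(-x_2,x_1)\big)^2-B\Big]+V_\omega$$ with Dirichlet boundary conditions on $M=[-m,m]^2$. For $\overline L>0$, $R\ge1$ and a square $\Omega$ let $$\overline V_\Omega(x)=e^{-\mathrm{dist}(x,\partial\Omega)^2/\overline L^2}\,\mathbf 1(x\in\Omega)\,\mathbf 1(\mathrm{dist}(x,\partial\Omega)\ge R),$$ and, for $0<\beta<B/2$, $S_z=Q_z(s)$, let $$\overline H^{(B+2\beta)}_{S_z,\omega}=\tfrac12\Big[\big(-i\nabla-\tfrac{B+2\beta}2(-x_2,x_1)\big)^2-(B+2\beta)\Big]+V_\omega+\overline V_{S_z}$$ with Dirichlet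 boundary conditions on $S_z$. The expressions $\langle g,Hg\rangle$ denote the quadratic forms of these operators. Put $\widetilde M=[-m-s,m+s]^2$. **Proposition.** For every $\overline L>0$ there is $R_0\ge1$, depending only on $\overline L$, with $R_0=1$ if $\overline L\le1000$, such that the following holds for all $R\ge R_0$ and $s\ge4R$. There is a smooth $\theta:\mathbb R^2\to[0,1]$ with $\theta=1$ on $[-\frac s2,\frac s2]^2$, $\theta=0$ outside $[-\frac{3s}4,\frac{3s}4]^2$ and $\|\nabla\theta\|_\infty\le 8s^{-1}$ such that, for all $B,\beta,m,V^{(0)},\omega$ as above with $s\le m$, $\beta<1/(2\overline L^2)$ and $\beta s^2\ge128$, the functions $$\eta_z(x)=\theta(x-z)\,e^{-\beta|x-z|^2/2}\,e^{i\beta(x_2z_1-x_1z_2)},\qquad z\in\mathbb R^2,$$ are supported on $S_z$, and for every $f\in H^1_0(M)$: $f$ is in the form domain of $H_{M,\omega}$; $f\eta_z$ is in the form domain of $\overline H^{(B+2\beta)}_{S_z,\omega}$ for every $z$; the integrand below is integrable over $\widetilde M$; and $$\langle f,H_{M,\omega}f\rangle\ \ge\ \frac{\beta}{2\pi}\int_{\widetilde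 M}\langle f\eta_z,\overline H^{(B+2\beta)}_{S_z,\omega}f\eta_z\rangle\,dz\ -\ 65\,s^{-2}e^{-\beta s^2/8}\,\|f\|^2_{L^2(M)}.$$ -/

import Mathlib

open MeasureTheory Filter Topology Set
open scoped ENNReal

noncomputable section

/-- The Euclidean plane. -/
abbrev Plane : Type := EuclideanSpace ℝ (Fin 2)

/-- The closed square with centre `z` and half side length `r`, that is `z + [-r, r]^2`. -/
def square (z : Plane) (r : ℝ) : Set Plane := {x | ∀ j, |x j - z j| ≤ r}

/-! ### Weak derivatives and the space `H^1_0` -/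

/-- `g` is the `j`-th weak partial derivative of `f` on the plane. -/
def HasWeakPartial (j : Fin 2) (f g : Plane → ℂ) : Prop :=
  LocallyIntegrable f volume ∧ LocallyIntegrable g volume ∧
    ∀ φ : Plane → ℝ, ContDiff ℝ (⊤ : ℕ∞) φ → HasCompactSupport φ →
      ∫ x, f x * ((fderiv ℝ φ x (EuclideanSpace.single j 1) : ℝ) : ℂ) =
        -∫ x, g x * ((φ x : ℝ) : ℂ)

open Classical in
/-- The `j`-th weak partial derivative of `f` (unique up to a null set, and `0` if there is
none). -/
def weakPartial (j : Fin 2) (f : Plane → ℂ) : Plane → ℂ :=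
  if h : ∃ g, HasWeakPartial j f g then h.choose else 0

/-- `f` belongs to `H^1_0` of the interior of `Q` (extended by zero to the plane): it is in `L^2`
with weak first derivatives in `L^2`, and it is a limit, in the norm of `H^1`, of smooth functions
with compact support in the interior of `Q`. -/
structure IsH10 (Q : Set Plane) (f : Plane → ℂ) : Prop where
  memLp : MemLp f 2 volume
  weak : ∀ j, HasWeakPartial j f (weakPartial j f)
  memLp_partial : ∀ j, MemLp (weakPartial j f) 2 volume
  approx : ∃ φ : ℕ → Plane → ℂ,
    (∀ n, ContDiff ℝ (⊤ : ℕ∞) (φ n) ∧ HasCompactSupport (φ n) ∧ tsupport (φ n) ⊆ interior Q) ∧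
    Tendsto (fun n => eLpNorm (fun x => φ n x - f x) 2 volume) atTop (𝓝 0) ∧
    ∀ j, Tendsto (fun n => eLpNorm
      (fun x => fderiv ℝ (φ n) x (EuclideanSpace.single j 1) - weakPartial j f x) 2 volume)
      atTop (𝓝 0)

/-! ### Magnetic Schroedinger forms -/

/-- The standard gauge `(b / 2) (-x₂, x₁)` of the constant magnetic field `b`. -/
def standardGauge (b : ℝ) (x : Plane) : Fin 2 → ℝ := ![-(b / 2) * x 1, (b / 2) * x 0]

/-- `∫ |(-i∇ - A) f|^2`, where `A` is the standard gauge of the constant field `b`. -/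
def magneticEnergy (b : ℝ) (f : Plane → ℂ) : ℝ :=
  ∑ j : Fin 2, ∫ x, ‖-Complex.I * weakPartial j f x - ((standardGauge b x j : ℝ) : ℂ) * f x‖ ^ 2

/-- `∫ W |f|^2` for a potential `W` with values in `[0, ∞]`. -/
def potentialEnergy (W : Plane → ℝ≥0∞) (f : Plane → ℂ) : ℝ≥0∞ :=
  ∫⁻ x, W x * ‖f x‖ₑ ^ 2

/-- The form domain of `½ [(-i∇ - A)^2 - b] + W` on `Q` with Dirichlet boundary conditions:
functions in `H^1_0(Q)` of finite potential energy. -/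
def InFormDomain (Q : Set Plane) (W : Plane → ℝ≥0∞) (f : Plane → ℂ) : Prop :=
  IsH10 Q f ∧ potentialEnergy W f < ∞

/-- The quadratic form `⟨f, (½ [(-i∇ - A)^2 - b] + W) f⟩`, for `f` in the form domain. -/
def schrodingerForm (b : ℝ) (W : Plane → ℝ≥0∞) (f : Plane → ℂ) : ℝ :=
  1 / 2 * (magneticEnergy b f - b * ∫ x, ‖f x‖ ^ 2) + (potentialEnergy W f).toReal

/-! ### Potentials -/

/-- The impurity potential `V_ω(x) = ∑ i, V⁰ (x - x_i)` of a countable configuration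
`ω = (x_i)` of impurities, with a nonnegative profile `V⁰`. -/
def impurityPotential {ι : Type*} (V0 : Plane → ℝ) (ω : ι → Plane) (x : Plane) : ℝ≥0∞ :=
  ∑' i, ENNReal.ofReal (V0 (x - ω i))

/-- Local square integrability of a potential with values in `[0, ∞]`. -/
def LocallySquareIntegrable (W : Plane → ℝ≥0∞) : Prop :=
  ∀ K : Set Plane, IsCompact K → ∫⁻ x in K, W x ^ 2 < ∞

open Classical in
/-- The boundary potential
`exp (-(dist (x, ∂Ω))^2 / Lbar^2) 1(x ∈ Ω) 1(dist (x, ∂Ω) ≥ R)`. -/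
def boundaryPotential (Lbar R : ℝ) (Ω : Set Plane) (x : Plane) : ℝ≥0∞ :=
  if x ∈ Ω ∧ R ≤ Metric.infDist x (frontier Ω) then
    ENNReal.ofReal (Real.exp (-(Metric.infDist x (frontier Ω)) ^ 2 / Lbar ^ 2))
  else 0

/-! ### Localizing functions -/

/-- A smooth cutoff at scale `s`: equal to `1` on `[-s/2, s/2]^2`, equal to `0` outside
`[-3s/4, 3s/4]^2`, with values in `[0, 1]` and gradient at most `8 / s`. -/
structure IsCutoff (s : ℝ) (θ : Plane → ℝ) : Prop where
  smooth : ContDiff ℝ (⊤ : ℕ∞) θ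
  eq_one : ∀ x ∈ square 0 (s / 2), θ x = 1
  eq_zero : ∀ x ∉ square 0 (3 * s / 4), θ x = 0
  nonneg : ∀ x, 0 ≤ θ x
  le_one : ∀ x, θ x ≤ 1
  gradient_le : ∀ x, ‖fderiv ℝ θ x‖ ≤ 8 / s

/-- `η_z(x) = θ(x - z) exp (-β |x - z|^2 / 2) exp (i β (x₂ z₁ - x₁ z₂))`. -/
def localizer (β : ℝ) (θ : Plane → ℝ) (z x : Plane) : ℂ :=
  ((θ (x - z) : ℝ) : ℂ) * ((Real.exp (-(β * ‖x - z‖ ^ 2 / 2)) : ℝ) : ℂ) *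
    Complex.exp (Complex.I * ((β * (x 1 * z 0 - x 0 * z 1) : ℝ) : ℂ))

end

/-! Up to a divergence, the magnetic energy lowered by its ground state energy is the norm of the
annihilation operator: for `D_b = π₁ + i π₂` in the field `b`, `‖π f‖² - b ‖f‖² = ‖D_b f‖²` on
`H^1_0` of a bounded set (`HasH10Gradient.integral_landauLowering`).

The Gaussian with phase inside `η_z` is a magnetic translate of the ground state of field `2β`, so
multiplication by it intertwines `D_B` with `D_(B+2β)` exactly. Hence `D_(B+2β) (f η_z) = η_z D_B f`
plus a term that contains only derivatives of `θ` (`landauLowering_mul_localizer`). Splitting the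
square by `½|u+v|² ≤ |u|² + |v|²` and integrating over `z`, with `∫ |η_z(x)|² dz ≤ π/β`, the
prefactor `β/(2π)` returns precisely `½ ‖D_B f‖²`. The potential returns at most half of `∫ V |f|²`,
and `V ≥ 0` allows this.

Two errors remain, both exponentially small. Derivatives of `θ` vanish where `|x-z|_∞ < s/2`, so
half of the Gaussian exponent yields `exp(-βs²/8)`, with constant `64` from the gradient bound
(`sq_norm_cutoffTerm_mul_exp_le`). On the support of `θ`, at distance at least `s/4` from the
boundary of the square, the boundary potential times half of the Gaussian obeys the same bound with
constant `1` (`exp_boundary_le`). The remaining half Gaussian integrates to `2π/β`, whence `64 + 1 =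
65`.

Finiteness of the potential energy follows from `H^1_0 ⊂ L⁴` in the plane, since `V` is locally in
`L²` (`HasH10Gradient.memLp_four`). -/

noncomputable section

/-! ### Weak gradients and `H^1_0` -/

/-- `f` belongs to `H^1_0` of the interior of `Q`, with weak gradient `g`. -/
structure HasH10Gradient (Q : Set Plane) (f : Plane → ℂ) (g : Fin 2 → Plane → ℂ) : Prop where
  memLp : MemLp f 2 volume
  memLp_grad : ∀ j, MemLp (g j) 2 volume
  approx : ∃ φ : ℕ → Plane → ℂ,
    (∀ n, ContDiff ℝ (⊤ : ℕ∞) (φ n) ∧ HasCompactSupport (φ n) ∧ tsupport (φ n) ⊆ interior Q) ∧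
    Tendsto (fun n => eLpNorm (fun x => φ n x - f x) 2 volume) atTop (𝓝 0) ∧
    ∀ j, Tendsto (fun n => eLpNorm
      (fun x => fderiv ℝ (φ n) x (EuclideanSpace.single j 1) - g j x) 2 volume) atTop (𝓝 0)

lemma IsH10.hasH10Gradient {Q : Set Plane} {f : Plane → ℂ} (h : IsH10 Q f) :
    HasH10Gradient Q f (fun j => weakPartial j f) :=
  ⟨h.memLp, h.memLp_partial, h.approx⟩

lemma HasCompactSupport.memLp_of_continuous {F : Type*} [NormedAddCommGroup F] {φ : Plane → F}
    (h : HasCompactSupport φ) (hc : Continuous φ) (p : ℝ≥0∞) : MemLp φ p volume :=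
  hc.memLp_of_hasCompactSupport h

lemma ContDiff.continuous_partial {F : Type*} [NormedAddCommGroup F] [NormedSpace ℝ F]
    {φ : Plane → F} (h : ContDiff ℝ (⊤ : ℕ∞) φ) (v : Plane) :
    Continuous fun x => fderiv ℝ φ x v :=
  (h.continuous_fderiv (by simp)).clm_apply continuous_const

lemma ContDiff.contDiff_partial {F : Type*} [NormedAddCommGroup F] [NormedSpace ℝ F]
    {φ : Plane → F} (h : ContDiff ℝ (⊤ : ℕ∞) φ) (v : Plane) :
    ContDiff ℝ (⊤ : ℕ∞) fun x => fderiv ℝ φ x v :=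
  (h.fderiv_right (m := ((⊤ : ℕ∞) : WithTop ℕ∞)) (by norm_cast)).clm_apply contDiff_const

lemma HasCompactSupport.partialDeriv {F : Type*} [NormedAddCommGroup F] [NormedSpace ℝ F]
    {φ : Plane → F} (h : HasCompactSupport φ) (v : Plane) :
    HasCompactSupport fun x => fderiv ℝ φ x v :=
  h.fderiv_apply ℝ v

lemma tendsto_integral_mul_of_tendsto_eLpNorm {h : ℕ → Plane → ℂ} {h₀ k : Plane → ℂ}
    (hm : ∀ n, MemLp (h n) 2 volume) (h₀m : MemLp h₀ 2 volume) (hk : MemLp k 2 volume)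
    (ht : Tendsto (fun n => eLpNorm (fun x => h n x - h₀ x) 2 volume) atTop (𝓝 0)) :
    Tendsto (fun n => ∫ x, h n x * k x) atTop (𝓝 (∫ x, h₀ x * k x)) := by
  refine tendsto_integral_of_L1' _ (h₀m.1.mul hk.1)
    (Eventually.of_forall fun n => (hm n).integrable_mul hk) ?_
  have hle : ∀ n, eLpNorm ((fun x => h n x * k x) - fun x => h₀ x * k x) 1 volume ≤
      eLpNorm (fun x => h n x - h₀ x) 2 volume * eLpNorm k 2 volume := fun n => by
    have := eLpNorm_smul_le_mul_eLpNorm (p := 2) (q := 2) (r := 1) hk.1 ((hm n).sub h₀m).1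
    refine le_trans (le_of_eq ?_) this
    congr 1
    ext x
    simp [sub_mul]
  refine tendsto_of_tendsto_of_tendsto_of_le_of_le tendsto_const_nhds ?_ (fun _ => zero_le) hle
  simpa using ENNReal.Tendsto.mul_const ht (Or.inr hk.2.ne)

lemma integral_mul_partial_of_hasCompactSupport {𝕜 : Type*} [RCLike 𝕜] {φ ψ : Plane → 𝕜}
    (hφ : ContDiff ℝ (⊤ : ℕ∞) φ) (hφc : HasCompactSupport φ) (hψ : ContDiff ℝ (⊤ : ℕ∞) ψ)
    (v : Plane) : ∫ x, φ x * fderiv ℝ ψ x v = -∫ x, fderiv ℝ φ x v * ψ x := by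
  refine integral_mul_fderiv_eq_neg_fderiv_mul_of_integrable ?_ ?_ ?_
    (fun x _ => (hφ.differentiable (by simp)).differentiableAt)
    (fun x _ => (hψ.differentiable (by simp)).differentiableAt)
  · exact ((hφ.continuous_partial v).mul hψ.continuous).integrable_of_hasCompactSupport
      (hφc.partialDeriv v).mul_right
  · exact (hφ.continuous.mul (hψ.continuous_partial v)).integrable_of_hasCompactSupport
      hφc.mul_right
  · exact (hφ.continuous.mul hψ.continuous).integrable_of_hasCompactSupport hφc.mul_right

lemma fderiv_ofReal_comp {ψ : Plane → ℝ} (hψ : ContDiff ℝ (⊤ : ℕ∞) ψ) (x v : Plane) :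
    fderiv ℝ (fun y => ((ψ y : ℝ) : ℂ)) x v = ((fderiv ℝ ψ x v : ℝ) : ℂ) := by
  have h1 : HasFDerivAt ψ (fderiv ℝ ψ x) x :=
    (hψ.differentiable (by simp)).differentiableAt.hasFDerivAt
  have h2 := Complex.ofRealCLM.hasFDerivAt.comp x h1
  have : (fun y => ((ψ y : ℝ) : ℂ)) = Complex.ofRealCLM ∘ ψ := rfl
  rw [this, h2.fderiv]
  simp

/-- Integration by parts holds for the smooth approximants, and both sides are continuous in `L²`
against a fixed test function. -/
lemma HasH10Gradient.hasWeakPartial {Q : Set Plane} {f : Plane → ℂ} {g : Fin 2 → Plane → ℂ}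
    (h : HasH10Gradient Q f g) (j : Fin 2) : HasWeakPartial j f (g j) := by
  refine ⟨h.memLp.locallyIntegrable one_le_two, (h.memLp_grad j).locallyIntegrable one_le_two,
    fun ψ hψ hψc => ?_⟩
  obtain ⟨φ, hφ, hf, hg⟩ := h.approx
  have hψ' : ContDiff ℝ (⊤ : ℕ∞) fun x => ((ψ x : ℝ) : ℂ) := Complex.ofRealCLM.contDiff.comp hψ
  have hψc' : HasCompactSupport fun x => ((ψ x : ℝ) : ℂ) :=
    hψc.comp_left (g := fun t : ℝ => (t : ℂ)) (by simp)
  have t1 := tendsto_integral_mul_of_tendsto_eLpNorm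
    (fun n => (hφ n).2.1.memLp_of_continuous (hφ n).1.continuous 2) h.memLp
    ((hψc'.partialDeriv (EuclideanSpace.single j 1)).memLp_of_continuous
      (hψ'.continuous_partial _) 2) hf
  have t2 := (tendsto_integral_mul_of_tendsto_eLpNorm
    (fun n => ((hφ n).2.1.partialDeriv (EuclideanSpace.single j 1)).memLp_of_continuous
      ((hφ n).1.continuous_partial _) 2) (h.memLp_grad j)
    (hψc'.memLp_of_continuous hψ'.continuous 2) (hg j)).neg
  simp only [integral_mul_partial_of_hasCompactSupport (hφ _).1 (hφ _).2.1 hψ'] at t1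
  have := tendsto_nhds_unique t1 t2
  simpa only [fderiv_ofReal_comp hψ] using this

lemma HasWeakPartial.ae_eq {j : Fin 2} {f g g' : Plane → ℂ} (h : HasWeakPartial j f g)
    (h' : HasWeakPartial j f g') : g =ᵐ[volume] g' := by
  have hz := ae_eq_zero_of_integral_contDiff_smul_eq_zero (μ := volume) (h.2.1.sub h'.2.1) ?_
  · filter_upwards [hz] with x hx using sub_eq_zero.1 hx
  intro ψ hψ hψc
  have hi : ∀ {k : Plane → ℂ}, LocallyIntegrable k volume →
      Integrable (fun x => k x * ((ψ x : ℝ) : ℂ)) volume := fun {k} hk => by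
    have := hk.integrable_smul_left_of_hasCompactSupport hψ.continuous hψc
    simpa [mul_comm] using this
  have e1 := h.2.2 ψ hψ hψc
  have e2 := h'.2.2 ψ hψ hψc
  have : ∫ x, ψ x • (g - g') x = (∫ x, g x * ((ψ x : ℝ) : ℂ)) - ∫ x, g' x * ((ψ x : ℝ) : ℂ) := by
    rw [← integral_sub (hi h.2.1) (hi h'.2.1)]
    congr 1
    ext x
    simp only [Pi.sub_apply, Complex.real_smul]
    ring
  rw [this]
  linear_combination e1 - e2

lemma HasWeakPartial.weakPartial_ae_eq {j : Fin 2} {f g : Plane → ℂ} (h : HasWeakPartial j f g) :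
    weakPartial j f =ᵐ[volume] g := by
  have hex : ∃ g, HasWeakPartial j f g := ⟨g, h⟩
  have : HasWeakPartial j f (weakPartial j f) := by
    rw [weakPartial, dif_pos hex]
    exact hex.choose_spec
  exact this.ae_eq h

lemma HasH10Gradient.congr {Q : Set Plane} {f : Plane → ℂ} {g g' : Fin 2 → Plane → ℂ}
    (h : HasH10Gradient Q f g) (hg : ∀ j, g j =ᵐ[volume] g' j) : HasH10Gradient Q f g' := by
  refine ⟨h.memLp, fun j => (h.memLp_grad j).ae_eq (hg j), ?_⟩
  obtain ⟨φ, hφ, h1, h2⟩ := h.approx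
  refine ⟨φ, hφ, h1, fun j => (h2 j).congr fun n => eLpNorm_congr_ae ?_⟩
  filter_upwards [hg j] with x hx
  rw [hx]

/-- By uniqueness of weak derivatives the explicit gradient may be exchanged for the chosen
representative `weakPartial`. -/
lemma HasH10Gradient.isH10 {Q : Set Plane} {f : Plane → ℂ} {g : Fin 2 → Plane → ℂ}
    (h : HasH10Gradient Q f g) : IsH10 Q f := by
  have hw := fun j => (h.hasWeakPartial j).weakPartial_ae_eq
  have h' := h.congr fun j => (hw j).symm
  exact ⟨h'.memLp, h'.hasWeakPartial, h'.memLp_grad, h'.approx⟩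

lemma tendsto_eLpNorm_of_le {p : ℝ≥0∞} {F G : ℕ → Plane → ℂ} {C : ℝ}
    (hle : ∀ n, ∀ᵐ x, ‖F n x‖ ≤ C * ‖G n x‖)
    (hG : Tendsto (fun n => eLpNorm (G n) p volume) atTop (𝓝 0)) :
    Tendsto (fun n => eLpNorm (F n) p volume) atTop (𝓝 0) := by
  refine tendsto_of_tendsto_of_tendsto_of_le_of_le tendsto_const_nhds ?_ (fun _ => zero_le)
    (fun n => eLpNorm_le_mul_eLpNorm_of_ae_le_mul (hle n) p)
  simpa using ENNReal.Tendsto.const_mul (a := ENNReal.ofReal C) hG (Or.inr ENNReal.ofReal_ne_top)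

lemma tendsto_eLpNorm_add {F G : ℕ → Plane → ℂ}
    (hFm : ∀ n, AEStronglyMeasurable (F n) volume) (hGm : ∀ n, AEStronglyMeasurable (G n) volume)
    (hF : Tendsto (fun n => eLpNorm (F n) 2 volume) atTop (𝓝 0))
    (hG : Tendsto (fun n => eLpNorm (G n) 2 volume) atTop (𝓝 0)) :
    Tendsto (fun n => eLpNorm (fun x => F n x + G n x) 2 volume) atTop (𝓝 0) := by
  refine tendsto_of_tendsto_of_tendsto_of_le_of_le tendsto_const_nhds ?_ (fun _ => zero_le)
    (fun n => eLpNorm_add_le (hFm n) (hGm n) one_le_two)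
  simpa using hF.add hG

/-- Multiplication by a smooth function with compact support in the interior of `Q'`. -/
lemma HasH10Gradient.mul {Q Q' : Set Plane} {f : Plane → ℂ} {g : Fin 2 → Plane → ℂ}
    (h : HasH10Gradient Q f g) {η : Plane → ℂ} (hη : ContDiff ℝ (⊤ : ℕ∞) η)
    (hηc : HasCompactSupport η) (hηs : tsupport η ⊆ interior Q') :
    HasH10Gradient Q' (fun x => f x * η x)
      (fun j x => g j x * η x + f x * fderiv ℝ η x (EuclideanSpace.single j 1)) := by
  obtain ⟨C, hC⟩ := hη.continuous.bounded_above_of_compact_support hηc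
  have hD : ∀ j : Fin 2, ∃ D, ∀ x, ‖fderiv ℝ η x (EuclideanSpace.single j 1)‖ ≤ D := fun j =>
    (hη.continuous_partial _).bounded_above_of_compact_support (hηc.partialDeriv _)
  choose D hD using hD
  have mη : ∀ {u : Plane → ℂ}, MemLp u 2 volume → MemLp (fun x => u x * η x) 2 volume :=
    fun {u} hu => hu.of_le_mul (c := C) (hu.1.mul hη.continuous.aestronglyMeasurable)
      (Eventually.of_forall fun x => by
        rw [norm_mul, mul_comm]
        exact mul_le_mul_of_nonneg_right (hC x) (norm_nonneg _))
  have mD : ∀ (j : Fin 2) {u : Plane → ℂ}, MemLp u 2 volume →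
      MemLp (fun x => u x * fderiv ℝ η x (EuclideanSpace.single j 1)) 2 volume :=
    fun j {u} hu => hu.of_le_mul (c := D j)
      (hu.1.mul (hη.continuous_partial _).aestronglyMeasurable)
      (Eventually.of_forall fun x => by
        rw [norm_mul, mul_comm]
        exact mul_le_mul_of_nonneg_right (hD j x) (norm_nonneg _))
  refine ⟨mη h.memLp, fun j => (mη (h.memLp_grad j)).add (mD j h.memLp), ?_⟩
  obtain ⟨φ, hφ, h1, h2⟩ := h.approx
  have φm : ∀ n, MemLp (φ n) 2 volume := fun n =>
    (hφ n).2.1.memLp_of_continuous (hφ n).1.continuous 2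
  have φm' : ∀ n j, MemLp (fun x => fderiv ℝ (φ n) x (EuclideanSpace.single j 1)) 2 volume :=
    fun n j => ((hφ n).2.1.partialDeriv _).memLp_of_continuous ((hφ n).1.continuous_partial _) 2
  refine ⟨fun n x => φ n x * η x, fun n => ⟨(hφ n).1.mul hη, (hφ n).2.1.mul_right,
    (tsupport_mul_subset_right).trans hηs⟩, ?_, fun j => ?_⟩
  · refine tendsto_eLpNorm_of_le (C := C) (fun n => Eventually.of_forall fun x => ?_) h1
    rw [← sub_mul, norm_mul, mul_comm]
    exact mul_le_mul_of_nonneg_right (hC x) (norm_nonneg _)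
  · have a1 := tendsto_eLpNorm_of_le (C := C) (F := fun n x =>
      (fderiv ℝ (φ n) x (EuclideanSpace.single j 1) - g j x) * η x)
      (fun n => Eventually.of_forall fun x => by
        rw [norm_mul, mul_comm]
        exact mul_le_mul_of_nonneg_right (hC x) (norm_nonneg _)) (h2 j)
    have a2 := tendsto_eLpNorm_of_le (C := D j) (F := fun n x =>
      (φ n x - f x) * fderiv ℝ η x (EuclideanSpace.single j 1))
      (fun n => Eventually.of_forall fun x => by
        rw [norm_mul, mul_comm]
        exact mul_le_mul_of_nonneg_right (hD j x) (norm_nonneg _)) h1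
    have := tendsto_eLpNorm_add (fun n => (mη ((φm' n j).sub (h.memLp_grad j))).1)
      (fun n => (mD j ((φm n).sub h.memLp)).1) a1 a2
    refine this.congr fun n => ?_
    congr 1
    ext x
    rw [fderiv_fun_mul ((hφ n).1.differentiable (by simp)).differentiableAt
      (hη.differentiable (by simp)).differentiableAt]
    simp only [add_apply, smul_apply, Pi.sub_apply, smul_eq_mul]
    ring

/-- The approximants vanish off `Q`, so the `L²` mass of `f` there is bounded by the approximation
error. -/
lemma HasH10Gradient.ae_eq_zero {Q : Set Plane} (hQ : MeasurableSet Q) {f : Plane → ℂ}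
    {g : Fin 2 → Plane → ℂ} (h : HasH10Gradient Q f g) : ∀ᵐ x, x ∉ Q → f x = 0 := by
  obtain ⟨φ, hφ, h1, -⟩ := h.approx
  have hle : ∀ n, eLpNorm f 2 (volume.restrict Qᶜ) ≤ eLpNorm (fun x => φ n x - f x) 2 volume := by
    intro n
    refine le_trans (le_of_eq ?_) (eLpNorm_mono_measure _ (Measure.restrict_le_self (s := Qᶜ)))
    refine eLpNorm_congr_norm_ae ?_
    filter_upwards [ae_restrict_mem hQ.compl] with x hx
    have : φ n x = 0 := image_eq_zero_of_notMem_tsupport fun hx' =>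
      hx (interior_subset ((hφ n).2.2 hx'))
    simp [this]
  have h0 : eLpNorm f 2 (volume.restrict Qᶜ) = 0 :=
    le_antisymm (ge_of_tendsto' h1 hle) zero_le
  rw [eLpNorm_eq_zero_iff h.memLp.1.restrict (by simp)] at h0
  exact (ae_restrict_iff' hQ.compl).1 h0

/-! ### The lowering operator and the magnetic energy -/

/-- The component `-i g - A f` of the magnetic gradient, where `g` is the gradient of `f` and `A`
the standard gauge of the field `b`. -/
def magneticPartial (b : ℝ) (f : Plane → ℂ) (g : Fin 2 → Plane → ℂ) (j : Fin 2) (x : Plane) : ℂ :=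
  -Complex.I * g j x - ((standardGauge b x j : ℝ) : ℂ) * f x

/-- The annihilation operator `(-i∂₁ - A₁) + i (-i∂₂ - A₂)` of the lowest Landau level of the
field `b`, applied to a function `f` with gradient `g`. -/
def landauLowering (b : ℝ) (f : Plane → ℂ) (g : Fin 2 → Plane → ℂ) (x : Plane) : ℂ :=
  magneticPartial b f g 0 x + Complex.I * magneticPartial b f g 1 x

lemma continuous_standardGauge (b : ℝ) (j : Fin 2) :
    Continuous fun x : Plane => ((standardGauge b x j : ℝ) : ℂ) := by
  fin_cases j <;> simp [standardGauge] <;> fun_prop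

/-- With `p₁`, `p₂` the two magnetic components, the difference is the cross term `-2 Im (p₁ conj
p₂)`. The product of the gauge terms is real and drops out; what survives is twice the Jacobian of
`(u, v)` and the gauge against the gradient of `u² + v²`. -/
lemma normSq_landauLowering_pointwise (a₁ a₂ u v u₁ u₂ v₁ v₂ : ℝ) :
    ‖-Complex.I * (⟨u₁, v₁⟩ : ℂ) - (a₁ : ℂ) * ⟨u, v⟩‖ ^ 2 +
      ‖-Complex.I * (⟨u₂, v₂⟩ : ℂ) - (a₂ : ℂ) * ⟨u, v⟩‖ ^ 2 -
      ‖(-Complex.I * (⟨u₁, v₁⟩ : ℂ) - (a₁ : ℂ) * ⟨u, v⟩) +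
        Complex.I * (-Complex.I * (⟨u₂, v₂⟩ : ℂ) - (a₂ : ℂ) * ⟨u, v⟩)‖ ^ 2 =
      2 * (u₁ * v₂ - u₂ * v₁) - a₂ * (2 * (u * u₁ + v * v₁)) + a₁ * (2 * (u * u₂ + v * v₂)) := by
  simp only [Complex.sq_norm, Complex.normSq_apply, Complex.add_re, Complex.add_im, Complex.sub_re,
    Complex.sub_im, Complex.mul_re, Complex.mul_im, Complex.neg_re, Complex.neg_im, Complex.I_re,
    Complex.I_im, Complex.ofReal_re, Complex.ofReal_im]
  ring

lemma fderiv_re_apply {φ : Plane → ℂ} (h : ContDiff ℝ (⊤ : ℕ∞) φ) (x v : Plane) :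
    fderiv ℝ (fun y => (φ y).re) x v = (fderiv ℝ φ x v).re := by
  have h2 := Complex.reCLM.hasFDerivAt.comp x
    (h.differentiable (by simp)).differentiableAt.hasFDerivAt
  rw [show (fun y => (φ y).re) = Complex.reCLM ∘ φ from rfl, h2.fderiv]
  simp

lemma fderiv_im_apply {φ : Plane → ℂ} (h : ContDiff ℝ (⊤ : ℕ∞) φ) (x v : Plane) :
    fderiv ℝ (fun y => (φ y).im) x v = (fderiv ℝ φ x v).im := by
  have h2 := Complex.imCLM.hasFDerivAt.comp x
    (h.differentiable (by simp)).differentiableAt.hasFDerivAt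
  rw [show (fun y => (φ y).im) = Complex.imCLM ∘ φ from rfl, h2.fderiv]
  simp

lemma fderiv_partial_comm {u : Plane → ℝ} (h : ContDiff ℝ (⊤ : ℕ∞) u) (x v w : Plane) :
    fderiv ℝ (fun y => fderiv ℝ u y v) x w = fderiv ℝ (fun y => fderiv ℝ u y w) x v := by
  have hd : DifferentiableAt ℝ (fderiv ℝ u) x :=
    ((h.fderiv_right (m := ((⊤ : ℕ∞) : WithTop ℕ∞)) (by norm_cast)).differentiable
      (by simp)).differentiableAt
  have hs : IsSymmSndFDerivAt ℝ u x :=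
    h.contDiffAt.isSymmSndFDerivAt (by simpa using (WithTop.coe_le_coe.2 (le_top : (2 : ℕ∞) ≤ ⊤)))
  rw [fderiv_clm_apply hd (differentiableAt_const _),
    fderiv_clm_apply hd (differentiableAt_const _)]
  simpa using hs w v

lemma fderiv_coord (x : Plane) (i j : Fin 2) :
    fderiv ℝ (fun y : Plane => y i) x (EuclideanSpace.single j 1) = if i = j then 1 else 0 := by
  have : (fun y : Plane => y i) = EuclideanSpace.proj (𝕜 := ℝ) i := rfl
  rw [this, ContinuousLinearMap.fderiv]
  simp

lemma integrable_mul_partial {u w : Plane → ℝ} (hu : ContDiff ℝ (⊤ : ℕ∞) u)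
    (hc : HasCompactSupport u) (hw : ContDiff ℝ (⊤ : ℕ∞) w) (v v' : Plane) :
    Integrable (fun x => fderiv ℝ u x v * fderiv ℝ w x v') volume :=
  ((hu.continuous_partial v).mul (hw.continuous_partial v')).integrable_of_hasCompactSupport
    (hc.partialDeriv v).mul_right

/-- Moving the derivative off `u` turns both sides into the integral of `-u` against the same mixed
second derivative of `w`. The Jacobian therefore integrates to zero. -/
lemma integral_partial_mul_partial_comm {u w : Plane → ℝ} (hu : ContDiff ℝ (⊤ : ℕ∞) u)
    (hc : HasCompactSupport u) (hw : ContDiff ℝ (⊤ : ℕ∞) w) (v v' : Plane) :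
    ∫ x, fderiv ℝ u x v * fderiv ℝ w x v' = ∫ x, fderiv ℝ u x v' * fderiv ℝ w x v := by
  have h1 := integral_mul_partial_of_hasCompactSupport hu hc (hw.contDiff_partial v') v
  have h2 := integral_mul_partial_of_hasCompactSupport hu hc (hw.contDiff_partial v) v'
  simp only [fderiv_partial_comm hw _ v' v] at h1
  linarith

lemma contDiff_coord (j : Fin 2) : ContDiff ℝ (⊤ : ℕ∞) fun x : Plane => x j :=
  (EuclideanSpace.proj (𝕜 := ℝ) j).contDiff

lemma integral_partial_mul_coord {n : Plane → ℝ} (hn : ContDiff ℝ (⊤ : ℕ∞) n)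
    (hc : HasCompactSupport n) (j : Fin 2) :
    ∫ x : Plane, fderiv ℝ n x (EuclideanSpace.single j 1) * x j = -∫ x, n x := by
  have := integral_mul_partial_of_hasCompactSupport hn hc (contDiff_coord j)
    (EuclideanSpace.single j 1)
  simp only [fderiv_coord, if_true, mul_one] at this
  linarith

lemma contDiff_sq_norm {φ : Plane → ℂ} (hφ : ContDiff ℝ (⊤ : ℕ∞) φ) :
    ContDiff ℝ (⊤ : ℕ∞) fun x => ‖φ x‖ ^ 2 := hφ.norm_sq ℝ

lemma fderiv_sq_norm_apply {φ : Plane → ℂ} (hφ : ContDiff ℝ (⊤ : ℕ∞) φ) (x v : Plane) :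
    fderiv ℝ (fun y => ‖φ y‖ ^ 2) x v =
      2 * ((φ x).re * (fderiv ℝ φ x v).re + (φ x).im * (fderiv ℝ φ x v).im) := by
  have h := (hφ.differentiable (by simp)).differentiableAt (x := x) |>.hasFDerivAt.norm_sq
  rw [h.fderiv]
  simp [Complex.inner]
  ring

lemma normSq_landauLowering_sub (b : ℝ) {φ : Plane → ℂ} (hφ : ContDiff ℝ (⊤ : ℕ∞) φ)
    {g : Fin 2 → Plane → ℂ} (e : Fin 2 → Plane) (hg : ∀ j x, g j x = fderiv ℝ φ x (e j))
    (x : Plane) :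
    ‖magneticPartial b φ g 0 x‖ ^ 2 + ‖magneticPartial b φ g 1 x‖ ^ 2 -
      ‖landauLowering b φ g x‖ ^ 2 =
      2 * (fderiv ℝ (fun y => (φ y).re) x (e 0) * fderiv ℝ (fun y => (φ y).im) x (e 1) -
        fderiv ℝ (fun y => (φ y).re) x (e 1) * fderiv ℝ (fun y => (φ y).im) x (e 0)) -
      b / 2 * (fderiv ℝ (fun y => ‖φ y‖ ^ 2) x (e 0) * x 0 +
        fderiv ℝ (fun y => ‖φ y‖ ^ 2) x (e 1) * x 1) := by
  have := normSq_landauLowering_pointwise (standardGauge b x 0) (standardGauge b x 1)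
    (φ x).re (φ x).im (fderiv ℝ φ x (e 0)).re (fderiv ℝ φ x (e 1)).re
    (fderiv ℝ φ x (e 0)).im (fderiv ℝ φ x (e 1)).im
  simp only [Complex.eta] at this
  rw [fderiv_sq_norm_apply hφ, fderiv_sq_norm_apply hφ, fderiv_re_apply hφ, fderiv_im_apply hφ,
    fderiv_re_apply hφ, fderiv_im_apply hφ]
  simp only [landauLowering, magneticPartial, hg]
  rw [this]
  simp only [standardGauge, Matrix.cons_val_zero, Matrix.cons_val_one]
  ring

lemma integrable_sq_norm_of_hasCompactSupport {w : Plane → ℂ} (hw : Continuous w)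
    (hc : HasCompactSupport w) : Integrable (fun x => ‖w x‖ ^ 2) volume :=
  (memLp_two_iff_integrable_sq_norm hw.aestronglyMeasurable).1 (hc.memLp_of_continuous hw 2)

/-- The Jacobian contributes nothing. The field `x` has divergence `2`, so integrating `-(b/2) x ·
∇n` by parts gives `b ∫ n`. -/
lemma integral_divergence_terms (b : ℝ) {u v n : Plane → ℝ} (hu : ContDiff ℝ (⊤ : ℕ∞) u)
    (huc : HasCompactSupport u) (hv : ContDiff ℝ (⊤ : ℕ∞) v) (hn : ContDiff ℝ (⊤ : ℕ∞) n)
    (hnc : HasCompactSupport n) (e : Fin 2 → Plane) (he : ∀ j, e j = EuclideanSpace.single j 1) :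
    ∫ x, (2 * (fderiv ℝ u x (e 0) * fderiv ℝ v x (e 1) -
        fderiv ℝ u x (e 1) * fderiv ℝ v x (e 0)) -
      b / 2 * (fderiv ℝ n x (e 0) * x 0 + fderiv ℝ n x (e 1) * x 1)) = b * ∫ x, n x := by
  have hin : ∀ j, Integrable (fun x : Plane => fderiv ℝ n x (e j) * x j) volume := fun j =>
    ((hn.continuous_partial (e j)).mul (contDiff_coord j).continuous).integrable_of_hasCompactSupport
      (hnc.partialDeriv (e j)).mul_right
  have huv := fun j k => integrable_mul_partial hu huc hv (e j) (e k)
  have hn0 := integral_partial_mul_coord hn hnc 0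
  have hn1 := integral_partial_mul_coord hn hnc 1
  rw [← he] at hn0 hn1
  have huv' := integral_partial_mul_partial_comm hu huc hv (e 0) (e 1)
  have hJ : Integrable (fun x => fderiv ℝ u x (e 0) * fderiv ℝ v x (e 1) -
      fderiv ℝ u x (e 1) * fderiv ℝ v x (e 0)) volume := (huv 0 1).sub (huv 1 0)
  have hN : Integrable (fun x => fderiv ℝ n x (e 0) * x 0 + fderiv ℝ n x (e 1) * x 1) volume :=
    (hin 0).add (hin 1)
  rw [integral_sub (hJ.const_mul 2) (hN.const_mul _),
    integral_const_mul, integral_const_mul, integral_sub (huv 0 1) (huv 1 0),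
    integral_add (hin 0) (hin 1), hn0, hn1, huv']
  ring

/-- The identity `|π f|² - b |f|² = |(π₁ + i π₂) f|²`, up to a divergence. -/
lemma integral_landauLowering_smooth (b : ℝ) {φ : Plane → ℂ} (hφ : ContDiff ℝ (⊤ : ℕ∞) φ)
    (hc : HasCompactSupport φ) {g : Fin 2 → Plane → ℂ}
    (hg : ∀ j x, g j x = fderiv ℝ φ x (EuclideanSpace.single j 1)) :
    (∑ j, ∫ x, ‖magneticPartial b φ g j x‖ ^ 2) - b * ∫ x, ‖φ x‖ ^ 2 =
      ∫ x, ‖landauLowering b φ g x‖ ^ 2 := by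
  have gcont : ∀ j, Continuous (g j) := fun j => by
    rw [funext (hg j)]
    exact hφ.continuous_partial _
  have gc : ∀ j, HasCompactSupport (g j) := fun j => by
    rw [funext (hg j)]
    exact hc.partialDeriv _
  have pcont : ∀ j, Continuous (magneticPartial b φ g j) := fun j =>
    (continuous_const.mul (gcont j)).sub ((continuous_standardGauge b j).mul hφ.continuous)
  have pc : ∀ j, HasCompactSupport (magneticPartial b φ g j) := fun j =>
    ((gc j).mul_left).sub hc.mul_left
  have hi := fun j => integrable_sq_norm_of_hasCompactSupport (pcont j) (pc j)
  have hi01 : Integrable (fun x => ‖magneticPartial b φ g 0 x‖ ^ 2 +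
      ‖magneticPartial b φ g 1 x‖ ^ 2) volume := (hi 0).add (hi 1)
  have hil : Integrable (fun x => ‖landauLowering b φ g x‖ ^ 2) volume :=
    integrable_sq_norm_of_hasCompactSupport ((pcont 0).add (continuous_const.mul (pcont 1)))
      ((pc 0).add (pc 1).mul_left)
  have hdiv := integral_divergence_terms b (u := fun y => (φ y).re) (v := fun y => (φ y).im)
    (Complex.reCLM.contDiff.comp hφ) (hc.comp_left (g := Complex.re) rfl)
    (Complex.imCLM.contDiff.comp hφ) (contDiff_sq_norm hφ)
    (hc.norm.comp_left (g := fun t : ℝ => t ^ 2) (zero_pow two_ne_zero)) _ fun _ => rfl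
  rw [← integral_congr_ae (Eventually.of_forall (normSq_landauLowering_sub b hφ _ hg)),
    integral_sub hi01 hil, integral_add (hi 0) (hi 1)] at hdiv
  rw [Fin.sum_univ_two]
  linarith

lemma integral_sq_norm_eq_toReal {f : Plane → ℂ} (hf : MemLp f 2 volume) :
    ∫ x, ‖f x‖ ^ 2 = (eLpNorm f 2 volume).toReal ^ 2 := by
  have h0 : 0 ≤ ∫ x, ‖f x‖ ^ 2 := integral_nonneg fun x => by positivity
  rw [hf.eLpNorm_eq_integral_rpow_norm (by simp) (by simp), ENNReal.toReal_ofReal (by positivity)]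
  simp only [ENNReal.toReal_ofNat, Real.rpow_ofNat]
  rw [← Real.rpow_natCast, ← Real.rpow_mul h0]
  norm_num

lemma tendsto_integral_sq_norm {h : ℕ → Plane → ℂ} {h₀ : Plane → ℂ}
    (hm : ∀ n, MemLp (h n) 2 volume) (h₀m : MemLp h₀ 2 volume)
    (ht : Tendsto (fun n => eLpNorm (fun x => h n x - h₀ x) 2 volume) atTop (𝓝 0)) :
    Tendsto (fun n => ∫ x, ‖h n x‖ ^ 2) atTop (𝓝 (∫ x, ‖h₀ x‖ ^ 2)) := by
  have := ((Lp.tendsto_Lp_iff_tendsto_eLpNorm'' h hm h₀ h₀m).2 ht).norm.pow 2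
  simpa only [Lp.norm_toLp, ← integral_sq_norm_eq_toReal (hm _), ← integral_sq_norm_eq_toReal h₀m]
    using this

lemma exists_norm_standardGauge_le {Q : Set Plane} (hQ : Bornology.IsBounded Q) (b : ℝ) :
    ∃ C, ∀ x ∈ Q, ∀ j, ‖((standardGauge b x j : ℝ) : ℂ)‖ ≤ C := by
  obtain ⟨r, hr⟩ := hQ.exists_norm_le
  refine ⟨|b / 2| * r, fun x hx j => ?_⟩
  have h : ∀ i, |x i| ≤ r := fun i => by
    have := PiLp.norm_apply_le x i
    exact this.trans (hr x hx)
  rw [Complex.norm_real, Real.norm_eq_abs]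
  fin_cases j
  · simpa [standardGauge, abs_mul] using mul_le_mul_of_nonneg_left (h 1) (abs_nonneg (b / 2))
  · simpa [standardGauge, abs_mul] using mul_le_mul_of_nonneg_left (h 0) (abs_nonneg (b / 2))

lemma memLp_standardGauge_mul {Q : Set Plane} (hQ : Bornology.IsBounded Q) (b : ℝ) (j : Fin 2)
    {f : Plane → ℂ} (hf : MemLp f 2 volume) (h0 : ∀ᵐ x, x ∉ Q → f x = 0) :
    MemLp (fun x => ((standardGauge b x j : ℝ) : ℂ) * f x) 2 volume := by
  obtain ⟨C, hC⟩ := exists_norm_standardGauge_le hQ b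
  refine hf.of_le_mul (c := C) ((continuous_standardGauge b j).aestronglyMeasurable.mul hf.1) ?_
  filter_upwards [h0] with x hx
  by_cases hxQ : x ∈ Q
  · rw [norm_mul]
    exact mul_le_mul_of_nonneg_right (hC x hxQ j) (norm_nonneg _)
  · simp [hx hxQ]

lemma memLp_magneticPartial {Q : Set Plane} (hQ : Bornology.IsBounded Q) (hQm : MeasurableSet Q)
    {f : Plane → ℂ} {g : Fin 2 → Plane → ℂ} (h : HasH10Gradient Q f g) (b : ℝ) (j : Fin 2) :
    MemLp (magneticPartial b f g j) 2 volume :=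
  ((h.memLp_grad j).const_mul _).sub (memLp_standardGauge_mul hQ b j h.memLp (h.ae_eq_zero hQm))

lemma memLp_landauLowering {Q : Set Plane} (hQ : Bornology.IsBounded Q) (hQm : MeasurableSet Q)
    {f : Plane → ℂ} {g : Fin 2 → Plane → ℂ} (h : HasH10Gradient Q f g) (b : ℝ) :
    MemLp (landauLowering b f g) 2 volume :=
  (memLp_magneticPartial hQ hQm h b 0).add ((memLp_magneticPartial hQ hQm h b 1).const_mul _)

/-- The magnetic energy, lowered by the ground state energy, is the energy of `π₁ + i π₂`. -/
lemma HasH10Gradient.integral_landauLowering {Q : Set Plane} (hQ : Bornology.IsBounded Q)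
    (hQm : MeasurableSet Q) {f : Plane → ℂ} {g : Fin 2 → Plane → ℂ} (h : HasH10Gradient Q f g)
    (b : ℝ) : magneticEnergy b f - b * ∫ x, ‖f x‖ ^ 2 = ∫ x, ‖landauLowering b f g x‖ ^ 2 := by
  obtain ⟨φ, hφ, h1, h2⟩ := h.approx
  have h0 := h.ae_eq_zero hQm
  obtain ⟨C, hC⟩ := exists_norm_standardGauge_le hQ b
  let γ : ℕ → Fin 2 → Plane → ℂ := fun n j x => fderiv ℝ (φ n) x (EuclideanSpace.single j 1)
  have φm : ∀ n, MemLp (φ n) 2 volume := fun n =>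
    (hφ n).2.1.memLp_of_continuous (hφ n).1.continuous 2
  have γm : ∀ n j, MemLp (γ n j) 2 volume :=
    fun n j => ((hφ n).2.1.partialDeriv _).memLp_of_continuous ((hφ n).1.continuous_partial _) 2
  have φ0 : ∀ n x, x ∉ Q → φ n x = 0 := fun n x hx =>
    image_eq_zero_of_notMem_tsupport fun hx' => hx (interior_subset ((hφ n).2.2 hx'))
  have d0 : ∀ n, ∀ᵐ x, x ∉ Q → φ n x - f x = 0 := fun n => by
    filter_upwards [h0] with x hx hxQ
    rw [hx hxQ, φ0 n x hxQ, sub_zero]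
  have φh : ∀ n, HasH10Gradient Q (φ n) (γ n) := fun n =>
    ⟨φm n, γm n, fun _ => φ n, fun _ => hφ n, by simp, by simp [γ]⟩
  have tp : ∀ j, Tendsto (fun n => eLpNorm
      (fun x => magneticPartial b (φ n) (γ n) j x - magneticPartial b f g j x) 2 volume)
      atTop (𝓝 0) := fun j => by
    have a1 := tendsto_eLpNorm_of_le (C := 1)
      (F := fun n x => -Complex.I * (γ n j x - g j x))
      (fun n => Eventually.of_forall fun x => by simp [γ]) (h2 j)
    -- The gauge is unbounded on the plane, but the difference vanishes off the bounded set `Q`,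
    -- where the gauge is at most `C`.
    have a2 := tendsto_eLpNorm_of_le (C := C)
      (F := fun n x => -((standardGauge b x j : ℝ) : ℂ) * (φ n x - f x))
      (fun n => by
        filter_upwards [d0 n] with x hx
        by_cases hxQ : x ∈ Q
        · rw [norm_mul, norm_neg]
          exact mul_le_mul_of_nonneg_right (hC x hxQ j) (norm_nonneg _)
        · simp [hx hxQ]) h1
    have := tendsto_eLpNorm_add
      (fun n => (((γm n j).sub (h.memLp_grad j)).const_mul (-Complex.I)).1)
      (fun n => (continuous_standardGauge b j).neg.aestronglyMeasurable.mul ((φm n).sub h.memLp).1)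
      a1 a2
    refine this.congr fun n => ?_
    congr 1
    ext x
    simp only [magneticPartial, Pi.sub_apply, Pi.neg_apply, Pi.mul_apply]
    ring
  have tl : Tendsto (fun n => eLpNorm
      (fun x => landauLowering b (φ n) (γ n) x - landauLowering b f g x) 2 volume)
      atTop (𝓝 0) := by
    have a2 := tendsto_eLpNorm_of_le (C := 1)
      (F := fun n x => Complex.I *
        (magneticPartial b (φ n) (γ n) 1 x - magneticPartial b f g 1 x))
      (fun n => Eventually.of_forall fun x => by simp) (tp 1)
    have mp := fun n j => (memLp_magneticPartial hQ hQm (φh n) b j).sub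
      (memLp_magneticPartial hQ hQm h b j)
    have := tendsto_eLpNorm_add (fun n => (mp n 0).1)
      (fun n => ((mp n 1).const_mul Complex.I).1) (tp 0) a2
    refine this.congr fun n => ?_
    congr 1
    ext x
    simp only [landauLowering, Pi.sub_apply]
    ring
  have t1 := fun j => tendsto_integral_sq_norm (fun n => memLp_magneticPartial hQ hQm (φh n) b j)
    (memLp_magneticPartial hQ hQm h b j) (tp j)
  have t2 := tendsto_integral_sq_norm φm h.memLp h1
  have t3 := tendsto_integral_sq_norm (fun n => memLp_landauLowering hQ hQm (φh n) b)
    (memLp_landauLowering hQ hQm h b) tl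
  have t4 := (tendsto_finsetSum Finset.univ fun j _ => t1 j).sub (t2.const_mul b)
  have t5 := tendsto_nhds_unique
    (t4.congr fun n => integral_landauLowering_smooth b (hφ n).1 (hφ n).2.1 fun _ _ => rfl) t3
  rw [← t5, magneticEnergy]
  congr 1
  refine Finset.sum_congr rfl fun j _ => integral_congr_ae ?_
  filter_upwards [(h.hasWeakPartial j).weakPartial_ae_eq] with x hx
  rw [hx, magneticPartial]

/-! ### Sobolev embedding and finite potential energy -/

lemma norm_fderiv_le_add {φ : Plane → ℂ} (x : Plane) :
    ‖fderiv ℝ φ x‖ ≤ ‖fderiv ℝ φ x (EuclideanSpace.single 0 1)‖ +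
      ‖fderiv ℝ φ x (EuclideanSpace.single 1 1)‖ := by
  refine ContinuousLinearMap.opNorm_le_bound _ (by positivity) fun v => ?_
  have hv : v = v 0 • EuclideanSpace.single 0 (1 : ℝ) + v 1 • EuclideanSpace.single 1 (1 : ℝ) := by
    ext j
    fin_cases j <;> simp
  have h : ∀ j, ‖v j‖ ≤ ‖v‖ := fun j => PiLp.norm_apply_le v j
  conv_lhs => rw [hv]
  rw [map_add, map_smul, map_smul, add_mul]
  refine (norm_add_le _ _).trans (add_le_add ?_ ?_) <;> rw [norm_smul, mul_comm]
  · exact mul_le_mul_of_nonneg_left (h 0) (norm_nonneg _)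
  · exact mul_le_mul_of_nonneg_left (h 1) (norm_nonneg _)

/-- Ladyzhenskaya's inequality for smooth functions supported in a bounded set. -/
lemma exists_eLpNorm_four_le {Q : Set Plane} (hQ : Bornology.IsBounded Q) :
    ∃ C : ℝ≥0∞, C ≠ ∞ ∧ ∀ φ : Plane → ℂ, ContDiff ℝ (⊤ : ℕ∞) φ → tsupport φ ⊆ interior Q →
      eLpNorm φ 4 volume ≤ C *
        (eLpNorm (fun x => fderiv ℝ φ x (EuclideanSpace.single 0 1)) 2 volume +
          eLpNorm (fun x => fderiv ℝ φ x (EuclideanSpace.single 1 1)) 2 volume) := by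
  -- In dimension two the Sobolev conjugate of `4/3` is `4`. The factor `V` is the Hölder cost of
  -- passing from `L^(4/3)` to `L²` on the bounded set `Q`.
  let K : ℝ≥0∞ := (eLpNormLESNormFDerivOfLeConst ℂ (volume : Measure Plane) Q (4 / 3) 4 : NNReal)
  let V : ℝ≥0∞ := volume.restrict Q univ ^
    (1 / ((4 / 3 : NNReal) : ℝ≥0∞).toReal - 1 / (2 : ℝ≥0∞).toReal)
  have hV : V ≠ ∞ := by
    refine ENNReal.rpow_ne_top_of_nonneg (by norm_num) ?_
    rw [Measure.restrict_apply_univ]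
    exact hQ.measure_lt_top.ne
  refine ⟨K * V, ENNReal.mul_ne_top ENNReal.coe_ne_top hV, fun φ hφ hs => ?_⟩
  have h43 : ((4 / 3 : NNReal) : ℝ≥0∞) ≤ 2 := by
    rw [show (2 : ℝ≥0∞) = ((2 : NNReal) : ℝ≥0∞) by simp, ENNReal.coe_le_coe, ← NNReal.coe_le_coe]
    norm_num
  have h1 := eLpNorm_le_eLpNorm_fderiv_of_le (μ := (volume : Measure Plane)) (u := φ) (s := Q)
    (p := 4 / 3) (q := 4) (hφ.of_le (by exact mod_cast le_top))
    ((subset_tsupport φ).trans (hs.trans interior_subset))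
    (by rw [← NNReal.coe_le_coe]; norm_num) (by rw [← NNReal.coe_lt_coe]; norm_num)
    (by norm_num) hQ
  have hsupp : Function.support (fderiv ℝ φ) ⊆ Q :=
    (support_fderiv_subset ℝ).trans (hs.trans interior_subset)
  have hc : Continuous (fderiv ℝ φ) := hφ.continuous_fderiv (by simp)
  have h2 : eLpNorm (fderiv ℝ φ) (4 / 3 : NNReal) volume ≤ V *
      (eLpNorm (fun x => fderiv ℝ φ x (EuclideanSpace.single 0 1)) 2 volume +
          eLpNorm (fun x => fderiv ℝ φ x (EuclideanSpace.single 1 1)) 2 volume) := by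
    rw [← eLpNorm_restrict_eq_of_support_subset (f := fderiv ℝ φ) hsupp]
    refine (eLpNorm_le_eLpNorm_mul_rpow_measure_univ h43 hc.aestronglyMeasurable).trans ?_
    rw [mul_comm]
    gcongr
    refine (eLpNorm_mono_measure _ Measure.restrict_le_self).trans ?_
    refine (eLpNorm_mono (g := fun x => ‖fderiv ℝ φ x (EuclideanSpace.single 0 1)‖ +
      ‖fderiv ℝ φ x (EuclideanSpace.single 1 1)‖) fun x => ?_).trans ?_
    · rw [Real.norm_of_nonneg (by positivity)]
      exact norm_fderiv_le_add x
    · refine (eLpNorm_add_le (hφ.continuous_partial _).norm.aestronglyMeasurable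
        (hφ.continuous_partial _).norm.aestronglyMeasurable one_le_two).trans ?_
      rw [eLpNorm_norm, eLpNorm_norm]
  rw [mul_assoc]
  exact h1.trans (mul_le_mul_right h2 _)

lemma HasH10Gradient.memLp_four {Q : Set Plane} (hQ : Bornology.IsBounded Q) {f : Plane → ℂ}
    {g : Fin 2 → Plane → ℂ} (h : HasH10Gradient Q f g) : MemLp f 4 volume := by
  refine ⟨h.memLp.1, ?_⟩
  obtain ⟨φ, hφ, h1, h2⟩ := h.approx
  obtain ⟨C, hC, hle⟩ := exists_eLpNorm_four_le hQ
  let M : ℝ≥0∞ := C * ((1 + eLpNorm (g 0) 2 volume) + (1 + eLpNorm (g 1) 2 volume))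
  have hM : M < ∞ := ENNReal.mul_lt_top hC.lt_top (ENNReal.add_lt_top.2
    ⟨ENNReal.add_lt_top.2 ⟨by simp, (h.memLp_grad 0).2⟩,
      ENNReal.add_lt_top.2 ⟨by simp, (h.memLp_grad 1).2⟩⟩)
  have hpart : ∀ j, ∀ᶠ n in atTop, eLpNorm
      (fun x => fderiv ℝ (φ n) x (EuclideanSpace.single j 1)) 2 volume ≤
        1 + eLpNorm (g j) 2 volume := fun j => by
    filter_upwards [(h2 j).eventually (ge_mem_nhds (zero_lt_one))] with n hn
    have hm := ((hφ n).1.continuous_partial (EuclideanSpace.single j 1)).aestronglyMeasurable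
      (μ := (volume : Measure Plane))
    have := eLpNorm_add_le (hm.sub (h.memLp_grad j).1) (h.memLp_grad j).1 one_le_two
    rw [sub_add_cancel] at this
    exact this.trans (add_le_add hn le_rfl)
  have hbd : ∀ᶠ n in atTop, eLpNorm (φ n) 4 volume ≤ M := by
    filter_upwards [hpart 0, hpart 1] with n h0 h1
    exact (hle _ (hφ n).1 (hφ n).2.2).trans (mul_le_mul_right (add_le_add h0 h1) C)
  -- `L²` convergence gives an almost everywhere convergent subsequence; Fatou carries the uniform
  -- `L⁴` bound to the limit.
  obtain ⟨ns, hns, hae⟩ := (tendstoInMeasure_of_tendsto_eLpNorm (p := 2) (by simp)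
    (fun n => (hφ n).1.continuous.aestronglyMeasurable) h.memLp.1 h1).exists_seq_tendsto_ae
  refine lt_of_le_of_lt (Lp.eLpNorm_lim_le_liminf_eLpNorm
    (fun n => (hφ (ns n)).1.continuous.aestronglyMeasurable) f hae) (lt_of_le_of_lt ?_ hM)
  exact liminf_le_of_frequently_le' (hns.tendsto_atTop.eventually hbd).frequently

/-- Cauchy–Schwarz on `Q`, where `W` is in `L²` and `|f|²` is in `L²` because `f` is in `L⁴`. -/
lemma LocallySquareIntegrable.potentialEnergy_lt_top {W : Plane → ℝ≥0∞}
    (hW : LocallySquareIntegrable W)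
    (hWm : AEMeasurable W volume) {Q : Set Plane} (hQ : IsCompact Q) {f : Plane → ℂ}
    {g : Fin 2 → Plane → ℂ} (h : HasH10Gradient Q f g) : potentialEnergy W f < ∞ := by
  have h0 := h.ae_eq_zero hQ.measurableSet
  have h4 := h.memLp_four hQ.isBounded
  have e1 : potentialEnergy W f = ∫⁻ x in Q, W x * ‖f x‖ₑ ^ 2 := by
    rw [potentialEnergy, ← lintegral_indicator hQ.measurableSet]
    refine lintegral_congr_ae ?_
    filter_upwards [h0] with x hx
    by_cases hxQ : x ∈ Q
    · simp [hxQ]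
    · simp [hxQ, hx hxQ]
  have hH := ENNReal.lintegral_mul_le_Lp_mul_Lq (volume.restrict Q)
    (Real.HolderConjugate.two_two) hWm.restrict
    (h4.1.enorm.pow_const 2).restrict
  rw [e1]
  refine lt_of_le_of_lt hH (ENNReal.mul_lt_top ?_ ?_)
  · refine ENNReal.rpow_lt_top_of_nonneg (by norm_num) ?_
    simpa using (hW Q hQ).ne
  · refine ENNReal.rpow_lt_top_of_nonneg (by norm_num) ?_
    have := lintegral_rpow_enorm_lt_top_of_eLpNorm_lt_top (by simp) (by simp) h4.2
    refine ne_of_lt (lt_of_le_of_lt (lintegral_mono' Measure.restrict_le_self le_rfl) ?_)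
    convert this using 3 with x
    simp only [ENNReal.rpow_ofNat, ENNReal.toReal_ofNat]
    rw [← pow_mul]

lemma aemeasurable_impurityPotential {ι : Type*} [Countable ι] {V0 : Plane → ℝ}
    (hV : ∀ K : Set Plane, IsCompact K → MemLp V0 2 (volume.restrict K)) (ω : ι → Plane) :
    AEMeasurable (impurityPotential V0 ω) volume := by
  have h1 : AEMeasurable V0 volume := by
    have hU : (⋃ n : ℕ, Metric.closedBall (0 : Plane) n) = univ := Metric.iUnion_closedBall_nat 0
    rw [← Measure.restrict_univ (μ := (volume : Measure Plane)), ← hU]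
    exact AEMeasurable.iUnion fun n =>
      (hV _ (isCompact_closedBall (0 : Plane) n)).1.aemeasurable
  refine AEMeasurable.tsum fun i => AEMeasurable.ennreal_ofReal ?_
  exact h1.comp_quasiMeasurePreserving
    (measurePreserving_sub_right volume (ω i)).quasiMeasurePreserving

/-! ### The maximum norm and the cutoff -/

lemma abs_sub_apply_le_norm (x y : Plane) (j : Fin 2) : |x j - y j| ≤ ‖x - y‖ := by
  simpa using PiLp.norm_apply_le (x - y) j

/-- The maximum norm on the plane. -/
def supNorm (x : Plane) : ℝ := max |x 0| |x 1|

lemma mem_square_iff {z x : Plane} {r : ℝ} : x ∈ square z r ↔ supNorm (x - z) ≤ r := by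
  simp [square, supNorm, Fin.forall_fin_two]

lemma supNorm_le_norm (x : Plane) : supNorm x ≤ ‖x‖ := by
  have h := fun j => abs_sub_apply_le_norm x 0 j
  simp only [PiLp.zero_apply, sub_zero] at h
  exact max_le (h 0) (h 1)

lemma supNorm_nonneg (x : Plane) : 0 ≤ supNorm x := (abs_nonneg _).trans (le_max_left _ _)

lemma supNorm_le_add (x y : Plane) : supNorm x ≤ supNorm y + supNorm (x - y) := by
  have key : ∀ j : Fin 2, |x j| ≤ |y j| + |(x - y) j| := fun j => by
    have := abs_add_le (y j) ((x - y) j)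
    simpa using this
  refine max_le ((key 0).trans ?_) ((key 1).trans ?_)
  · exact add_le_add (le_max_left _ _) (le_max_left _ _)
  · exact add_le_add (le_max_right _ _) (le_max_right _ _)

@[fun_prop]
lemma continuous_supNorm : Continuous supNorm := by
  unfold supNorm
  fun_prop

lemma abs_supNorm_sub_le (x y : Plane) : |supNorm x - supNorm y| ≤ ‖x - y‖ := by
  have h1 := supNorm_le_add x y
  have h2 := supNorm_le_add y x
  have h3 := supNorm_le_norm (x - y)
  have h4 := supNorm_le_norm (y - x)
  rw [norm_sub_rev] at h4
  rw [abs_le]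
  constructor <;> linarith

/-- The piecewise linear profile equal to `1` for `|x|_∞ ≤ 9 s / 16` and to `0` for
`|x|_∞ ≥ 11 s / 16`. -/
def squareRamp (s : ℝ) (x : Plane) : ℝ := max 0 (min 1 (8 / s * (11 * s / 16 - supNorm x)))

lemma squareRamp_nonneg (s : ℝ) (x : Plane) : 0 ≤ squareRamp s x := le_max_left _ _

lemma squareRamp_le_one (s : ℝ) (x : Plane) : squareRamp s x ≤ 1 :=
  max_le zero_le_one (min_le_left _ _)

lemma continuous_squareRamp (s : ℝ) : Continuous (squareRamp s) := by
  unfold squareRamp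
  fun_prop

lemma abs_squareRamp_sub_le {s : ℝ} (hs : 0 < s) (x y : Plane) :
    |squareRamp s x - squareRamp s y| ≤ 8 / s * ‖x - y‖ := by
  have h1 : |squareRamp s x - squareRamp s y| ≤
      |8 / s * (11 * s / 16 - supNorm x) - 8 / s * (11 * s / 16 - supNorm y)| := by
    unfold squareRamp
    refine (abs_max_sub_max_le_max _ _ _ _).trans ?_
    refine max_le (by simp) ((abs_min_sub_min_le_max _ _ _ _).trans (max_le (by simp) le_rfl))
  refine h1.trans ?_
  have : 8 / s * (11 * s / 16 - supNorm x) - 8 / s * (11 * s / 16 - supNorm y) =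
      8 / s * (supNorm y - supNorm x) := by ring
  rw [this, abs_mul, abs_of_pos (by positivity : 0 < 8 / s), norm_sub_rev]
  exact mul_le_mul_of_nonneg_left (abs_supNorm_sub_le y x) (by positivity)

lemma squareRamp_eq_one {s : ℝ} (hs : 0 < s) {x : Plane} (hx : supNorm x ≤ 9 * s / 16) :
    squareRamp s x = 1 := by
  have : 1 ≤ 8 / s * (11 * s / 16 - supNorm x) := by
    rw [div_mul_eq_mul_div, le_div_iff₀ hs]
    linarith
  rw [squareRamp, min_eq_left this, max_eq_right zero_le_one]

lemma squareRamp_eq_zero {s : ℝ} (hs : 0 < s) {x : Plane} (hx : 11 * s / 16 ≤ supNorm x) :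
    squareRamp s x = 0 := by
  have : 8 / s * (11 * s / 16 - supNorm x) ≤ 0 :=
    mul_nonpos_of_nonneg_of_nonpos (by positivity) (by linarith)
  exact max_eq_left ((min_le_right _ _).trans this)

/-- The ramp is mollified. Averaging against a probability density preserves the Lipschitz constant
`8/s` and the range `[0, 1]`. -/
lemma exists_isCutoff {s : ℝ} (hs : 0 < s) : ∃ θ : Plane → ℝ, IsCutoff s θ := by
  -- The outer radius `s/16` fits the margins `9s/16 - s/2` and `3s/4 - 11s/16`.
  let b : ContDiffBump (0 : Plane) := ⟨s / 32, s / 16, by positivity, by linarith⟩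
  let ρ : Plane → ℝ := b.normed volume
  have ρc : Continuous ρ := b.continuous_normed
  have ρ0 : ∀ t, 0 ≤ ρ t := b.nonneg_normed
  have ρs : HasCompactSupport ρ := b.hasCompactSupport_normed
  have ρ1 : ∫ t, ρ t = 1 := b.integral_normed
  have ρi : Integrable ρ volume := b.integrable_normed
  have ρz : ∀ t, s / 16 ≤ ‖t‖ → ρ t = 0 := fun t ht => by
    have : t ∉ Function.support ρ := by
      rw [b.support_normed_eq]
      simpa [b] using ht
    simpa using this
  let θ : Plane → ℝ := fun x => ∫ t, ρ t * squareRamp s (x - t)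
  have hint : ∀ x, Integrable (fun t => ρ t * squareRamp s (x - t)) volume := fun x =>
    (ρc.mul ((continuous_squareRamp s).comp (by fun_prop))).integrable_of_hasCompactSupport
      ρs.mul_right
  have hlip : ∀ x y, |θ x - θ y| ≤ 8 / s * ‖x - y‖ := fun x y => by
    have e : θ x - θ y = ∫ t, ρ t * (squareRamp s (x - t) - squareRamp s (y - t)) := by
      simp only [θ]
      rw [← integral_sub (hint x) (hint y)]
      simp only [mul_sub]
    rw [e, ← Real.norm_eq_abs]
    have hb : ∀ t, ‖ρ t * (squareRamp s (x - t) - squareRamp s (y - t))‖ ≤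
        ρ t * (8 / s * ‖x - y‖) := fun t => by
      rw [norm_mul, Real.norm_of_nonneg (ρ0 t), Real.norm_eq_abs]
      refine mul_le_mul_of_nonneg_left ?_ (ρ0 t)
      have := abs_squareRamp_sub_le hs (x - t) (y - t)
      simpa using this
    refine (norm_integral_le_of_norm_le (ρi.mul_const _) (Eventually.of_forall hb)).trans ?_
    rw [integral_mul_const, ρ1, one_mul]
  refine ⟨θ, ?_, ?_, ?_, fun x => ?_, fun x => ?_, fun x => ?_⟩
  · exact ρs.contDiff_convolution_left (ContinuousLinearMap.lsmul ℝ ℝ) b.contDiff_normed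
      (continuous_squareRamp s).locallyIntegrable
  · intro x hx
    rw [mem_square_iff, sub_zero] at hx
    have : ∀ t, ρ t * squareRamp s (x - t) = ρ t := fun t => by
      by_cases ht : s / 16 ≤ ‖t‖
      · simp [ρz t ht]
      · rw [squareRamp_eq_one hs, mul_one]
        have h1 := abs_supNorm_sub_le (x - t) x
        rw [abs_le] at h1
        have : x - t - x = -t := by abel
        rw [this, norm_neg] at h1
        linarith
    simp only [θ, this, ρ1]
  · intro x hx
    rw [mem_square_iff, sub_zero, not_le] at hx
    have : ∀ t, ρ t * squareRamp s (x - t) = 0 := fun t => by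
      by_cases ht : s / 16 ≤ ‖t‖
      · simp [ρz t ht]
      · rw [squareRamp_eq_zero hs, mul_zero]
        have h1 := abs_supNorm_sub_le (x - t) x
        rw [abs_le] at h1
        have : x - t - x = -t := by abel
        rw [this, norm_neg] at h1
        linarith
    simp only [θ, this, integral_zero]
  · exact integral_nonneg fun t => mul_nonneg (ρ0 t) (squareRamp_nonneg _ _)
  · rw [← ρ1]
    exact integral_mono (hint x) ρi fun t =>
      mul_le_of_le_one_right (ρ0 t) (squareRamp_le_one _ _)
  · have hl : LipschitzWith (Real.toNNReal (8 / s)) θ := LipschitzWith.of_dist_le_mul fun x y => by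
      rw [Real.dist_eq, dist_eq_norm, Real.coe_toNNReal _ (by positivity)]
      exact hlip x y
    have := norm_fderiv_le_of_lipschitz ℝ (x₀ := x) hl
    rwa [Real.coe_toNNReal _ (by positivity)] at this

/-! ### Squares and the boundary potential -/

lemma isClosed_square (z : Plane) (r : ℝ) : IsClosed (square z r) := by
  have : square z r = {x | supNorm (x - z) ≤ r} := Set.ext fun x => mem_square_iff
  rw [this]
  exact isClosed_le (by fun_prop) continuous_const

lemma norm_sq_eq_add (x : Plane) : ‖x‖ ^ 2 = x 0 ^ 2 + x 1 ^ 2 := by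
  simp [EuclideanSpace.norm_sq_eq, Fin.sum_univ_two]

lemma norm_le_two_mul_supNorm (x : Plane) : ‖x‖ ≤ 2 * supNorm x := by
  have h0 : |x 0| ≤ supNorm x := le_max_left _ _
  have h1 : |x 1| ≤ supNorm x := le_max_right _ _
  have hs := supNorm_nonneg x
  refine abs_le_of_sq_le_sq' ?_ (by positivity) |>.2
  rw [norm_sq_eq_add, ← sq_abs (x 0), ← sq_abs (x 1)]
  nlinarith [abs_nonneg (x 0), abs_nonneg (x 1)]

lemma isCompact_square (z : Plane) (r : ℝ) : IsCompact (square z r) := by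
  refine Metric.isCompact_of_isClosed_isBounded (isClosed_square z r)
    ((Metric.isBounded_closedBall (x := z) (r := 2 * r)).subset fun x hx => ?_)
  rw [mem_square_iff] at hx
  rw [Metric.mem_closedBall, dist_eq_norm]
  linarith [norm_le_two_mul_supNorm (x - z)]

lemma mem_interior_square {z x : Plane} {r : ℝ} (h : supNorm (x - z) < r) :
    x ∈ interior (square z r) :=
  interior_maximal (s := square z r) (t := {x | supNorm (x - z) < r})
    (fun _ hy => mem_square_iff.2 (le_of_lt hy)) (isOpen_lt (by fun_prop) continuous_const) h

lemma sub_supNorm_le_infDist_frontier {s : ℝ} (hs : 0 < s) (y : Plane) :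
    s - supNorm y ≤ Metric.infDist y (frontier (square 0 s)) := by
  -- `Metric.infDist` to the empty set is `0`, so the bound needs a nonempty frontier.
  have hne : (frontier (square 0 s)).Nonempty := by
    rw [nonempty_frontier_iff]
    refine ⟨⟨0, mem_square_iff.2 (by simp [supNorm, hs.le])⟩, fun h => ?_⟩
    have : EuclideanSpace.single 0 (s + 1) ∈ square 0 s := h ▸ mem_univ _
    have h0 := this 0
    simp only [PiLp.single_apply, if_true, PiLp.zero_apply, sub_zero] at h0
    linarith [le_abs_self (s + 1)]
  rw [Metric.le_infDist hne]
  intro p hp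
  have hp' : s ≤ supNorm p := by
    by_contra hlt
    exact hp.2 (mem_interior_square (by simpa using hlt))
  have := abs_supNorm_sub_le y p
  rw [abs_le] at this
  rw [dist_eq_norm]
  linarith

lemma infDist_frontier_square (s : ℝ) (z x : Plane) :
    Metric.infDist x (frontier (square z s)) = Metric.infDist (x - z) (frontier (square 0 s)) := by
  have h1 : square z s = Homeomorph.addRight z '' square 0 s := by
    ext y
    simp only [Homeomorph.coe_addRight, mem_image, mem_square_iff, sub_zero]
    exact ⟨fun h => ⟨y - z, h, by simp⟩, by rintro ⟨w, hw, rfl⟩; simpa using hw⟩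
  have h2 := Metric.infDist_image (x := x - z) (t := frontier (square 0 s))
    (IsometryEquiv.addRight z).isometry
  rw [h1, ← Homeomorph.image_frontier, ← h2]
  simp

/-- Translation to the centre `0` makes the joint measurability in `(z, x)` evident. -/
lemma boundaryPotential_square (Lbar R s : ℝ) (z x : Plane) :
    boundaryPotential Lbar R (square z s) x = boundaryPotential Lbar R (square 0 s) (x - z) := by
  simp only [boundaryPotential, infDist_frontier_square s z x, mem_square_iff, sub_zero]

lemma measurable_boundaryPotential (Lbar R : ℝ) (Ω : Set Plane) (hΩ : MeasurableSet Ω) :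
    Measurable (boundaryPotential Lbar R Ω) := by
  have hc : Continuous fun x => Metric.infDist x (frontier Ω) := Metric.continuous_infDist_pt _
  refine Measurable.ite (hΩ.inter (measurableSet_le measurable_const hc.measurable)) ?_
    measurable_const
  exact ENNReal.measurable_ofReal.comp
    (Real.measurable_exp.comp (((hc.measurable.pow_const 2).neg).div_const _))

lemma boundaryPotential_le_one (Lbar R : ℝ) (Ω : Set Plane) (x : Plane) :
    boundaryPotential Lbar R Ω x ≤ 1 := by
  unfold boundaryPotential
  split_ifs
  · rw [ENNReal.ofReal_le_one, Real.exp_le_one_iff, neg_div, neg_nonpos]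
    positivity
  · exact zero_le

lemma boundaryPotential_le {Lbar R s : ℝ} (hs : 0 < s) {y : Plane} (hy : supNorm y ≤ s) :
    boundaryPotential Lbar R (square 0 s) y ≤
      ENNReal.ofReal (Real.exp (-(s - supNorm y) ^ 2 / Lbar ^ 2)) := by
  have h := sub_supNorm_le_infDist_frontier hs y
  unfold boundaryPotential
  split_ifs
  · refine ENNReal.ofReal_le_ofReal (Real.exp_le_exp.2 ?_)
    have : (s - supNorm y) ^ 2 ≤ Metric.infDist y (frontier (square 0 s)) ^ 2 := by gcongr
    gcongr
  · exact zero_le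

/-- The boundary potential is negligible against the Gaussian weight where the cutoff lives. -/
lemma exp_boundary_le {Lbar β s t : ℝ} (hL : 0 < Lbar) (hβ : 0 < β) (hβL : β < 1 / (2 * Lbar ^ 2))
    (hs : 0 < s) (hβs : 128 ≤ β * s ^ 2) (hsL : Lbar ≤ 1000 ∨ 24 * Lbar ^ 2 ≤ s)
    (ht : t ≤ 3 * s / 4) :
    Real.exp (-(β * t ^ 2 / 2) + -(s - t) ^ 2 / Lbar ^ 2) ≤
      1 / s ^ 2 * Real.exp (-(β * s ^ 2 / 8)) := by
  obtain ⟨κ, hκ⟩ : ∃ κ, κ = 1 / Lbar ^ 2 := ⟨_, rfl⟩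
  have hκβ : 2 * β < κ := by
    have : 1 / (2 * Lbar ^ 2) = κ / 2 := by rw [hκ]; field_simp
    linarith
  have hκL : κ * Lbar ^ 2 = 1 := by rw [hκ]; field_simp
  obtain ⟨x, hx⟩ : ∃ x, x = κ * s ^ 2 / 16 := ⟨_, rfl⟩
  have hx0 : 0 < x := by rw [hx]; have : 0 < κ := by linarith
                         positivity
  have hsx : s ^ 2 = 16 * Lbar ^ 2 * x := by rw [hx]; linear_combination -s ^ 2 * hκL
  -- Since `κ ≥ 2β` and `(s-t)² ≥ s²/16`, the excess over `κs²/16` is at least `β(5t²/2 - 4st +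
  -- 7s²/4)`. For `t ≤ 3s/4` this is at least its value `5βs²/32` at `t = 3s/4`, and `βs² ≥ 128`
  -- makes that `20`.
  have hexp : x + 20 ≤ β * t ^ 2 / 2 + (s - t) ^ 2 * κ - β * s ^ 2 / 8 := by
    have h1 : s ^ 2 / 16 ≤ (s - t) ^ 2 := by nlinarith
    have h2 : 0 ≤ β * ((3 * s / 4 - t) * (17 / 8 * s - 5 / 2 * t)) :=
      mul_nonneg hβ.le (mul_nonneg (by linarith) (by linarith))
    have h3 := mul_nonneg (sub_nonneg.2 hκβ.le) (sub_nonneg.2 h1)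
    rw [hx]
    nlinarith
  have hs2 : s ^ 2 ≤ Real.exp (x + 20) := by
    have hxe : x ≤ Real.exp x := by linarith [Real.add_one_le_exp x]
    rcases hsL with h | h
    -- Here `s² = 16 Lbar² x` with `16 Lbar² ≤ 16 · 10⁶`, which `exp 20` absorbs; this is the source
    -- of the threshold `1000`.
    · have h20 : (16000000 : ℝ) ≤ Real.exp 20 := by
        have h1 : (2.5 : ℝ) ≤ Real.exp 1 := by linarith [Real.exp_one_gt_d9]
        have h2 : Real.exp 20 = Real.exp 1 ^ 20 := by rw [← Real.exp_nat_mul]; norm_num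
        rw [h2]
        exact le_trans (by norm_num) (pow_le_pow_left₀ (by norm_num) h1 20)
      have hL2 : Lbar ^ 2 ≤ 1000 ^ 2 := by gcongr
      rw [Real.exp_add, hsx, mul_comm]
      exact mul_le_mul hxe (by linarith) (by positivity) (by positivity)
    -- For large `Lbar`, `s ≥ 24 Lbar²` forces `x ≥ 32 Lbar²`, so `s² = 16 Lbar² x ≤ x²/2 ≤ exp x`.
    · have h1 := Real.quadratic_le_exp_of_nonneg hx0.le
      have h2 : (24 * Lbar ^ 2) ^ 2 ≤ s ^ 2 := by gcongr
      have h3 : 32 * Lbar ^ 2 ≤ x := by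
        have : 0 < Lbar ^ 2 := by positivity
        nlinarith
      have h4 : s ^ 2 ≤ x ^ 2 / 2 := by rw [hsx]; nlinarith
      have h5 : Real.exp x ≤ Real.exp (x + 20) := Real.exp_le_exp.2 (by linarith)
      linarith
  have hrw : -(β * t ^ 2 / 2) + -(s - t) ^ 2 / Lbar ^ 2 ≤ -(x + 20) + -(β * s ^ 2 / 8) := by
    have : -(s - t) ^ 2 / Lbar ^ 2 = -((s - t) ^ 2 * κ) := by rw [hκ]; ring
    rw [this]
    linarith
  refine (Real.exp_le_exp.2 hrw).trans ?_
  rw [Real.exp_add, Real.exp_neg, one_div]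
  gcongr

/-! ### The localizing functions -/

/-- The Gaussian factor of the localizing function `η_z`, with its magnetic phase. -/
def gaussianPhase (β : ℝ) (z x : Plane) : ℂ :=
  ((Real.exp (-(β * ‖x - z‖ ^ 2 / 2)) : ℝ) : ℂ) *
    Complex.exp (Complex.I * ((β * (x 1 * z 0 - x 0 * z 1) : ℝ) : ℂ))

lemma localizer_eq (β : ℝ) (θ : Plane → ℝ) (z x : Plane) :
    localizer β θ z x = ((θ (x - z) : ℝ) : ℂ) * gaussianPhase β z x := by
  rw [localizer, gaussianPhase, mul_assoc]

lemma norm_gaussianPhase (β : ℝ) (z x : Plane) :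
    ‖gaussianPhase β z x‖ = Real.exp (-(β * ‖x - z‖ ^ 2 / 2)) := by
  rw [gaussianPhase, norm_mul, mul_comm Complex.I, Complex.norm_exp_ofReal_mul_I, mul_one,
    Complex.norm_real, Real.norm_of_nonneg (Real.exp_nonneg _)]

lemma gaussianPhase_eq_exp (β : ℝ) (z x : Plane) :
    gaussianPhase β z x = Complex.exp
      (((-(β * ((x 0 - z 0) ^ 2 + (x 1 - z 1) ^ 2) / 2) : ℝ) : ℂ) +
        ((β * (x 1 * z 0 - x 0 * z 1) : ℝ) : ℂ) * Complex.I) := by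
  rw [gaussianPhase, norm_sq_eq_add, Complex.exp_add, Complex.ofReal_exp, mul_comm Complex.I]
  simp

lemma contDiff_gaussianPhase (β : ℝ) (z : Plane) : ContDiff ℝ (⊤ : ℕ∞) (gaussianPhase β z) := by
  have h : gaussianPhase β z = fun x => Complex.exp
      (((-(β * ((x 0 - z 0) ^ 2 + (x 1 - z 1) ^ 2) / 2) : ℝ) : ℂ) +
        ((β * (x 1 * z 0 - x 0 * z 1) : ℝ) : ℂ) * Complex.I) := funext (gaussianPhase_eq_exp β z)
  have h0 := contDiff_coord 0
  have h1 := contDiff_coord 1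
  rw [h]
  refine (ContDiff.add ?_ (ContDiff.mul ?_ contDiff_const)).cexp
  · exact Complex.ofRealCLM.contDiff.comp ((contDiff_const.mul
      (((h0.sub contDiff_const).pow 2).add ((h1.sub contDiff_const).pow 2))).div_const 2).neg
  · exact Complex.ofRealCLM.contDiff.comp (contDiff_const.mul
      ((h1.mul contDiff_const).sub (h0.mul contDiff_const)))

/-- The partial derivatives of the Gaussian factor. -/
lemma fderiv_gaussianPhase (β : ℝ) (z x : Plane) (j : Fin 2) :
    fderiv ℝ (gaussianPhase β z) x (EuclideanSpace.single j 1) =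
      ((-(β * (x j - z j)) : ℝ) + ((β * ![-z 1, z 0] j : ℝ) : ℂ) * Complex.I) *
        gaussianPhase β z x := by
  have h : gaussianPhase β z = fun x => Complex.exp
      (((-(β * ((x 0 - z 0) ^ 2 + (x 1 - z 1) ^ 2) / 2) : ℝ) : ℂ) +
        ((β * (x 1 * z 0 - x 0 * z 1) : ℝ) : ℂ) * Complex.I) := funext (gaussianPhase_eq_exp β z)
  have hd : DifferentiableAt ℝ (gaussianPhase β z) x :=
    ((contDiff_gaussianPhase β z).differentiable (by simp)).differentiableAt
  -- The partial derivative is computed along the line through `x` in direction `j`, and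
  -- one-variable derivatives are compared.
  have hline : HasDerivAt (fun t : ℝ => x + t • EuclideanSpace.single j (1 : ℝ))
      (EuclideanSpace.single j (1 : ℝ)) 0 := by
    simpa using ((hasDerivAt_id (0 : ℝ)).smul_const (EuclideanSpace.single j (1 : ℝ))).const_add x
  have hd' : HasFDerivAt (gaussianPhase β z) (fderiv ℝ (gaussianPhase β z) x)
      (x + (0 : ℝ) • EuclideanSpace.single j (1 : ℝ)) := by simpa using hd.hasFDerivAt
  have h1 := hd'.comp_hasDerivAt (0 : ℝ) hline
  have hc : ∀ i : Fin 2, HasDerivAt (fun t : ℝ => x i + t * (if i = j then 1 else 0))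
      (if i = j then 1 else 0) 0 := fun i => by
    simpa using ((hasDerivAt_id (0 : ℝ)).mul_const (if i = j then (1 : ℝ) else 0)).const_add (x i)
  have h2 := ((((((hc 0).sub_const (z 0)).pow 2).add (((hc 1).sub_const (z 1)).pow 2)).const_mul
    β).div_const 2).neg.ofReal_comp.add
    (((((hc 1).mul_const (z 0)).sub ((hc 0).mul_const (z 1))).const_mul β).ofReal_comp.mul_const
      Complex.I) |>.cexp
  refine (h1.unique (h2.congr_of_eventuallyEq (Eventually.of_forall fun t => ?_))).trans ?_
  · rw [Function.comp_apply, h]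
    simp [PiLp.single_apply]
  · rw [h]
    fin_cases j <;> simp <;> ring

lemma contDiff_localizer {s : ℝ} {θ : Plane → ℝ} (hθ : IsCutoff s θ) (β : ℝ) (z : Plane) :
    ContDiff ℝ (⊤ : ℕ∞) (localizer β θ z) := by
  rw [show localizer β θ z = fun x => ((θ (x - z) : ℝ) : ℂ) * gaussianPhase β z x from
    funext (localizer_eq β θ z)]
  exact (Complex.ofRealCLM.contDiff.comp (hθ.smooth.comp (contDiff_id.sub contDiff_const))).mul
    (contDiff_gaussianPhase β z)

lemma fderiv_localizer {s : ℝ} {θ : Plane → ℝ} (hθ : IsCutoff s θ) (β : ℝ) (z x : Plane)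
    (j : Fin 2) : fderiv ℝ (localizer β θ z) x (EuclideanSpace.single j 1) =
      ((fderiv ℝ θ (x - z) (EuclideanSpace.single j 1) : ℝ) : ℂ) * gaussianPhase β z x +
      ((-(β * (x j - z j)) : ℝ) + ((β * ![-z 1, z 0] j : ℝ) : ℂ) * Complex.I) *
        localizer β θ z x := by
  have hsm : ContDiff ℝ (⊤ : ℕ∞) fun x => θ (x - z) :=
    hθ.smooth.comp (contDiff_id.sub contDiff_const)
  have hdθ : DifferentiableAt ℝ (fun x => ((θ (x - z) : ℝ) : ℂ)) x :=
    ((Complex.ofRealCLM.contDiff.comp hsm).differentiable (by simp)).differentiableAt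
  rw [localizer_eq, show localizer β θ z = fun x => ((θ (x - z) : ℝ) : ℂ) * gaussianPhase β z x from
    funext (localizer_eq β θ z), fderiv_fun_mul hdθ
      (((contDiff_gaussianPhase β z).differentiable (by simp)).differentiableAt)]
  simp only [add_apply, smul_apply, smul_eq_mul, fderiv_gaussianPhase]
  rw [fderiv_ofReal_comp hsm, fderiv_comp_sub]
  ring

/-- The term of the lowering operator which comes from the cutoff. -/
def cutoffTerm (θ : Plane → ℝ) (y : Plane) : ℂ :=
  ((fderiv ℝ θ y (EuclideanSpace.single 0 1) : ℝ) : ℂ) +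
    Complex.I * ((fderiv ℝ θ y (EuclideanSpace.single 1 1) : ℝ) : ℂ)

/-- The Gaussian factor `G` satisfies `-i(∂₁ + i∂₂) G = iβ(x₁ + i x₂) G`: the phase cancels all
dependence on `z`. The right side is exactly the change of gauge from `B` to `B + 2β`, so only the
derivative of `θ` is left over. -/
lemma landauLowering_mul_localizer {s : ℝ} {θ : Plane → ℝ} (hθ : IsCutoff s θ) (B β : ℝ)
    (z x : Plane) (f : Plane → ℂ) (g : Fin 2 → Plane → ℂ) :
    landauLowering (B + 2 * β) (fun x => f x * localizer β θ z x)
      (fun j x => g j x * localizer β θ z x +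
        f x * fderiv ℝ (localizer β θ z) x (EuclideanSpace.single j 1)) x =
      localizer β θ z x * landauLowering B f g x +
        -Complex.I * (f x * (cutoffTerm θ (x - z) * gaussianPhase β z x)) := by
  simp only [landauLowering, magneticPartial, fderiv_localizer hθ, cutoffTerm, standardGauge,
    Matrix.cons_val_zero, Matrix.cons_val_one]
  push_cast
  linear_combination (f x * localizer β θ z x * β * (x 1 - Complex.I * z 0)) * Complex.I_sq

lemma tsupport_localizer_subset {s : ℝ} {θ : Plane → ℝ} (hθ : IsCutoff s θ) (β : ℝ) (z : Plane) :
    tsupport (localizer β θ z) ⊆ square z (3 * s / 4) := by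
  refine closure_minimal (fun x hx => ?_) (isClosed_square _ _)
  by_contra h
  refine hx ?_
  rw [localizer_eq, hθ.eq_zero (x - z) (by rwa [mem_square_iff, sub_zero, ← mem_square_iff])]
  simp

lemma square_subset_interior (z : Plane) {r s : ℝ} (h : r < s) :
    square z r ⊆ interior (square z s) := fun _ hx =>
  mem_interior_square ((mem_square_iff.1 hx).trans_lt h)

/-- Both derivatives of `θ` are real, so the left side is the squared length of the gradient;
testing the differential on the gradient vector bounds it by the operator norm. -/
lemma sq_norm_cutoffTerm_le (θ : Plane → ℝ) (y : Plane) :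
    ‖cutoffTerm θ y‖ ^ 2 ≤ ‖fderiv ℝ θ y‖ ^ 2 := by
  set ℓ := fderiv ℝ θ y
  set a := ℓ (EuclideanSpace.single 0 1) with ha
  set b := ℓ (EuclideanSpace.single 1 1) with hb
  have e : ‖cutoffTerm θ y‖ ^ 2 = a ^ 2 + b ^ 2 := by
    rw [cutoffTerm, Complex.sq_norm, Complex.normSq_apply]
    simp only [Complex.add_re, Complex.add_im, Complex.mul_re, Complex.mul_im, Complex.I_re,
      Complex.I_im, Complex.ofReal_re, Complex.ofReal_im]
    ring
  let v : Plane := a • EuclideanSpace.single 0 1 + b • EuclideanSpace.single 1 1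
  have hv : ‖v‖ ^ 2 = a ^ 2 + b ^ 2 := by simp [norm_sq_eq_add, v]
  have hl : ℓ v = a ^ 2 + b ^ 2 := by
    simp only [v, map_add, map_smul, smul_eq_mul, ← ha, ← hb]
    ring
  have h := (le_abs_self _).trans (ℓ.le_opNorm v)
  rw [hl, ← hv] at h
  rw [e, ← hv]
  rcases (norm_nonneg v).eq_or_lt with h0 | h0
  · rw [← h0, zero_pow two_ne_zero]
    positivity
  · have : ‖v‖ ≤ ‖ℓ‖ := by
      rw [sq] at h
      exact le_of_mul_le_mul_right h h0
    gcongr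

lemma cutoffTerm_eq_zero {s : ℝ} {θ : Plane → ℝ} (hθ : IsCutoff s θ) {y : Plane}
    (hy : supNorm y < s / 2) : cutoffTerm θ y = 0 := by
  have h : θ =ᶠ[𝓝 y] fun _ => 1 := by
    filter_upwards [isOpen_interior.mem_nhds
      (mem_interior_square (z := 0) (by simpa using hy))] with x hx
    exact hθ.eq_one x (interior_subset hx)
  simp [cutoffTerm, h.fderiv_eq]

/-- The cutoff term lives where `‖y‖ ≥ s/2`. Half of the Gaussian exponent is spent there on
`exp(-βs²/8)`; the other half stays integrable in `z`. -/
lemma sq_norm_cutoffTerm_mul_exp_le {s : ℝ} {θ : Plane → ℝ} (hθ : IsCutoff s θ) {β : ℝ}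
    (hβ : 0 < β) (y : Plane) : ‖cutoffTerm θ y‖ ^ 2 * Real.exp (-(β * ‖y‖ ^ 2)) ≤
      64 / s ^ 2 * Real.exp (-(β * s ^ 2 / 8)) * Real.exp (-(β / 2) * ‖y‖ ^ 2) := by
  rcases lt_or_ge (supNorm y) (s / 2) with h | h
  · rw [cutoffTerm_eq_zero hθ h]
    rw [norm_zero, zero_pow two_ne_zero, zero_mul]
    exact mul_nonneg (mul_nonneg (by positivity) (Real.exp_nonneg _)) (Real.exp_nonneg _)
  · have h1 : ‖cutoffTerm θ y‖ ^ 2 ≤ 64 / s ^ 2 := by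
      refine (sq_norm_cutoffTerm_le θ y).trans ((pow_le_pow_left₀ (norm_nonneg _)
        (hθ.gradient_le y) 2).trans (le_of_eq ?_))
      ring
    rw [mul_assoc, ← Real.exp_add]
    refine mul_le_mul h1 (Real.exp_le_exp.2 ?_) (Real.exp_nonneg _) (by positivity)
    have h2 : s / 2 ≤ ‖y‖ := h.trans (supNorm_le_norm y)
    rcases le_or_gt 0 s with hs | hs
    · have h3 : (s / 2) ^ 2 ≤ ‖y‖ ^ 2 := by gcongr
      nlinarith
    -- A negative `s` would make the bound `8/s` on a norm negative.
    · exfalso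
      have := (norm_nonneg _).trans (hθ.gradient_le 0)
      linarith [div_neg_of_pos_of_neg (by norm_num : (0 : ℝ) < 8) hs]

lemma sq_norm_localizer_le {s : ℝ} {θ : Plane → ℝ} (hθ : IsCutoff s θ) (β : ℝ) (z x : Plane) :
    ‖localizer β θ z x‖ ^ 2 ≤ Real.exp (-(β * ‖x - z‖ ^ 2)) := by
  rw [localizer_eq, norm_mul, mul_pow, norm_gaussianPhase, ← Real.exp_nat_mul, Complex.norm_real,
    Real.norm_of_nonneg (hθ.nonneg _)]
  refine (mul_le_of_le_one_left (Real.exp_nonneg _) (pow_le_one₀ (hθ.nonneg _) (hθ.le_one _))).trans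
    (le_of_eq ?_)
  congr 1
  push_cast
  ring

/-- Half of the Gaussian goes into `exp_boundary_le` with `t = |x - z|_∞ ≤ ‖x - z‖`; beyond `3s/4`
the localizer vanishes. -/
lemma boundaryPotential_mul_sq_norm_localizer_le {Lbar R β s : ℝ} (hL : 0 < Lbar) (hβ : 0 < β)
    (hβL : β < 1 / (2 * Lbar ^ 2)) (hs : 0 < s) (hβs : 128 ≤ β * s ^ 2)
    (hsL : Lbar ≤ 1000 ∨ 24 * Lbar ^ 2 ≤ s) {θ : Plane → ℝ} (hθ : IsCutoff s θ) (z x : Plane) :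
    boundaryPotential Lbar R (square 0 s) (x - z) * ENNReal.ofReal (‖localizer β θ z x‖ ^ 2) ≤
      ENNReal.ofReal (1 / s ^ 2 * Real.exp (-(β * s ^ 2 / 8)) *
        Real.exp (-(β / 2) * ‖x - z‖ ^ 2)) := by
  rcases le_or_gt (supNorm (x - z)) (3 * s / 4) with h | h
  · refine (mul_le_mul' (boundaryPotential_le hs (by linarith))
      (ENNReal.ofReal_le_ofReal (sq_norm_localizer_le hθ β z x))).trans ?_
    rw [← ENNReal.ofReal_mul (Real.exp_nonneg _)]
    refine ENNReal.ofReal_le_ofReal ?_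
    have h1 := exp_boundary_le hL hβ hβL hs hβs hsL h
    refine le_trans ?_ (mul_le_mul_of_nonneg_right h1 (Real.exp_nonneg _))
    rw [← Real.exp_add, ← Real.exp_add, Real.exp_le_exp]
    have h2 : supNorm (x - z) ^ 2 ≤ ‖x - z‖ ^ 2 :=
      pow_le_pow_left₀ (supNorm_nonneg _) (supNorm_le_norm _) 2
    nlinarith
  · have : localizer β θ z x = 0 := by
      rw [localizer_eq, hθ.eq_zero (x - z) (by rw [mem_square_iff, sub_zero]; exact not_le.2 h)]
      simp
    simp [this]

/-! ### Localized energies and their integral over the centres -/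

lemma enorm_sq_eq_ofReal (c : ℂ) : ‖c‖ₑ ^ 2 = ENNReal.ofReal (‖c‖ ^ 2) := by
  rw [ENNReal.ofReal_pow (norm_nonneg _), ofReal_norm]

lemma half_mul_enorm_add_sq_le (u v : ℂ) :
    2⁻¹ * ‖u + v‖ₑ ^ 2 ≤ ‖u‖ₑ ^ 2 + ‖v‖ₑ ^ 2 := by
  simp only [enorm_sq_eq_ofReal]
  rw [show (2⁻¹ : ℝ≥0∞) = ENNReal.ofReal 2⁻¹ by
      rw [ENNReal.ofReal_inv_of_pos two_pos, ENNReal.ofReal_ofNat],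
    ← ENNReal.ofReal_mul (by norm_num), ← ENNReal.ofReal_add (by positivity) (by positivity)]
  refine ENNReal.ofReal_le_ofReal ?_
  have h := norm_add_le u v
  have h0 := norm_nonneg (u + v)
  nlinarith [sq_nonneg (‖u‖ - ‖v‖)]

lemma integral_sq_norm_eq_toReal_lintegral {h : Plane → ℂ} (hm : AEStronglyMeasurable h volume) :
    ∫ x, ‖h x‖ ^ 2 = (∫⁻ x, ‖h x‖ₑ ^ 2).toReal := by
  have hm2 : AEStronglyMeasurable (fun x => ‖h x‖ ^ 2) volume := hm.norm.pow 2
  rw [integral_eq_lintegral_of_nonneg_ae (Eventually.of_forall fun x => by positivity) hm2]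
  simp only [enorm_sq_eq_ofReal]

lemma MeasureTheory.MemLp.lintegral_enorm_sq_ne_top {h : Plane → ℂ} (hm : MemLp h 2 volume) :
    ∫⁻ x, ‖h x‖ₑ ^ 2 ≠ ∞ := by
  simpa using (lintegral_rpow_enorm_lt_top_of_eLpNorm_lt_top (by simp) (by simp) hm.2).ne

/-- As a sum of nonnegative integrals the form can be handled by Tonelli without prior
integrability. -/
lemma HasH10Gradient.schrodingerForm_eq {Q : Set Plane} (hQ : Bornology.IsBounded Q)
    (hQm : MeasurableSet Q) {f : Plane → ℂ} {g : Fin 2 → Plane → ℂ} (h : HasH10Gradient Q f g)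
    (b : ℝ) {W : Plane → ℝ≥0∞} (hW : potentialEnergy W f ≠ ∞) :
    schrodingerForm b W f =
      (2⁻¹ * (∫⁻ x, ‖landauLowering b f g x‖ₑ ^ 2) + potentialEnergy W f).toReal := by
  have hm := memLp_landauLowering hQ hQm h b
  rw [schrodingerForm, h.integral_landauLowering hQ hQm, integral_sq_norm_eq_toReal_lintegral hm.1,
    ENNReal.toReal_add (ENNReal.mul_ne_top (by simp) hm.lintegral_enorm_sq_ne_top) hW,
    ENNReal.toReal_mul]
  simp

lemma lintegral_gaussian_sub {b : ℝ} (hb : 0 < b) {c : ℝ} (hc : 0 ≤ c) (x : Plane) :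
    ∫⁻ z : Plane, ENNReal.ofReal (c * Real.exp (-b * ‖x - z‖ ^ 2)) =
      ENNReal.ofReal (c * (Real.pi / b)) := by
  rw [lintegral_sub_left_eq_self (fun y : Plane => ENNReal.ofReal (c * Real.exp (-b * ‖y‖ ^ 2))) x]
  have hi : Integrable (fun y : Plane => Real.exp (-b * ‖y‖ ^ 2)) volume := by
    have := (GaussianFourier.integrable_cexp_neg_mul_sq_norm_add (V := Plane) (b := (b : ℂ))
      (by simpa using hb) 0 0).norm
    refine this.congr (Eventually.of_forall fun y => ?_)
    simp only [Complex.norm_exp]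
    congr 1
    simp [← Complex.ofReal_pow]
  rw [← ofReal_integral_eq_lintegral_ofReal (hi.const_mul c)
    (Eventually.of_forall fun y => mul_nonneg hc (Real.exp_nonneg _)), integral_const_mul,
    GaussianFourier.integral_rexp_neg_mul_sq_norm hb]
  simp

lemma continuous_gaussianPhase_uncurry (β : ℝ) :
    Continuous fun p : Plane × Plane => gaussianPhase β p.1 p.2 := by
  unfold gaussianPhase
  fun_prop

lemma IsCutoff.continuous_cutoffTerm {s : ℝ} {θ : Plane → ℝ} (hθ : IsCutoff s θ) :
    Continuous (cutoffTerm θ) :=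
  (Complex.continuous_ofReal.comp (hθ.smooth.continuous_partial _)).add
    (continuous_const.mul (Complex.continuous_ofReal.comp (hθ.smooth.continuous_partial _)))

lemma IsCutoff.continuous_localizer_uncurry {s : ℝ} {θ : Plane → ℝ} (hθ : IsCutoff s θ) (β : ℝ) :
    Continuous fun p : Plane × Plane => localizer β θ p.1 p.2 := by
  simp only [localizer_eq]
  exact (Complex.continuous_ofReal.comp (hθ.smooth.continuous.comp (by fun_prop))).mul
    (continuous_gaussianPhase_uncurry β)

lemma half_mul_enorm_localized_le {s β : ℝ} (hβ : 0 < β) {θ : Plane → ℝ} (hθ : IsCutoff s θ)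
    (z x : Plane) (d c : ℂ) :
    2⁻¹ * ‖localizer β θ z x * d + -Complex.I * (c * (cutoffTerm θ (x - z) *
      gaussianPhase β z x))‖ₑ ^ 2 ≤
      ENNReal.ofReal (1 * Real.exp (-β * ‖x - z‖ ^ 2)) * ‖d‖ₑ ^ 2 +
      ENNReal.ofReal (64 / s ^ 2 * Real.exp (-(β * s ^ 2 / 8)) *
        Real.exp (-(β / 2) * ‖x - z‖ ^ 2)) * ‖c‖ₑ ^ 2 := by
  refine (half_mul_enorm_add_sq_le _ _).trans (add_le_add ?_ ?_)
  · rw [enorm_mul, mul_pow, enorm_sq_eq_ofReal (localizer β θ z x)]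
    gcongr
    simpa using sq_norm_localizer_le hθ β z x
  · rw [enorm_mul, enorm_mul, enorm_neg, mul_pow, mul_pow, mul_comm (‖c‖ₑ ^ 2),
      enorm_sq_eq_ofReal (_ * _)]
    simp only [enorm_sq_eq_ofReal Complex.I, Complex.norm_I, one_pow, ENNReal.ofReal_one, one_mul]
    gcongr
    rw [norm_mul, mul_pow, norm_gaussianPhase, ← Real.exp_nat_mul]
    refine le_trans (le_of_eq ?_) (sq_norm_cutoffTerm_mul_exp_le hθ hβ (x - z))
    congr 2
    push_cast
    ring

lemma potential_mul_enorm_localized_le {Lbar R β s : ℝ} (hL : 0 < Lbar) (hβ : 0 < β)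
    (hβL : β < 1 / (2 * Lbar ^ 2)) (hs : 0 < s) (hβs : 128 ≤ β * s ^ 2)
    (hsL : Lbar ≤ 1000 ∨ 24 * Lbar ^ 2 ≤ s) {θ : Plane → ℝ} (hθ : IsCutoff s θ) (z x : Plane)
    (V : ℝ≥0∞) (c : ℂ) :
    (V + boundaryPotential Lbar R (square z s) x) * ‖c * localizer β θ z x‖ₑ ^ 2 ≤
      ENNReal.ofReal (1 * Real.exp (-β * ‖x - z‖ ^ 2)) * (V * ‖c‖ₑ ^ 2) +
      ENNReal.ofReal (1 / s ^ 2 * Real.exp (-(β * s ^ 2 / 8)) *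
        Real.exp (-(β / 2) * ‖x - z‖ ^ 2)) * ‖c‖ₑ ^ 2 := by
  rw [enorm_mul, mul_pow, add_mul]
  refine add_le_add ?_ ?_
  · rw [← mul_assoc, mul_comm, enorm_sq_eq_ofReal (localizer β θ z x)]
    gcongr
    simpa using sq_norm_localizer_le hθ β z x
  · rw [boundaryPotential_square, mul_left_comm, mul_comm, enorm_sq_eq_ofReal (localizer β θ z x)]
    exact mul_le_mul_left (boundaryPotential_mul_sq_norm_localizer_le hL hβ hβL hs hβs hsL hθ z x) _

/-- The energy `⟨f η_z, H f η_z⟩` of the localized function as an extended nonnegative number,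
where `D` is the lowering operator applied to `f`. -/
def localizedEnergy (Lbar R s β : ℝ) (θ : Plane → ℝ) (V : Plane → ℝ≥0∞) (f D : Plane → ℂ)
    (z : Plane) : ℝ≥0∞ :=
  2⁻¹ * (∫⁻ x, ‖localizer β θ z x * D x + -Complex.I * (f x * (cutoffTerm θ (x - z) *
    gaussianPhase β z x))‖ₑ ^ 2) +
  potentialEnergy (fun x => V x + boundaryPotential Lbar R (square z s) x)
    fun x => f x * localizer β θ z x

lemma aemeasurable_localizedEnergy (Lbar R : ℝ) {s : ℝ} (β : ℝ) {θ : Plane → ℝ}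
    (hθ : IsCutoff s θ) {V : Plane → ℝ≥0∞} (hV : AEMeasurable V volume) {f D : Plane → ℂ}
    (hf : AEStronglyMeasurable f volume) (hD : AEStronglyMeasurable D volume) :
    AEMeasurable (localizedEnergy Lbar R s β θ V f D) volume := by
  have hl : AEStronglyMeasurable (fun p : Plane × Plane => localizer β θ p.1 p.2)
      (volume.prod volume) := (hθ.continuous_localizer_uncurry β).aestronglyMeasurable
  have hg : AEStronglyMeasurable (fun p : Plane × Plane => cutoffTerm θ (p.2 - p.1) *
      gaussianPhase β p.1 p.2) (volume.prod volume) :=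
    ((hθ.continuous_cutoffTerm.comp (by fun_prop)).mul
      (continuous_gaussianPhase_uncurry β)).aestronglyMeasurable
  have hf2 : AEStronglyMeasurable (fun p : Plane × Plane => f p.2) (volume.prod volume) :=
    hf.comp_snd
  have hD2 : AEStronglyMeasurable (fun p : Plane × Plane => D p.2) (volume.prod volume) :=
    hD.comp_snd
  have hV2 : AEMeasurable (fun p : Plane × Plane => V p.2) (volume.prod volume) := hV.comp_snd
  have hb : Measurable fun p : Plane × Plane => boundaryPotential Lbar R (square p.1 s) p.2 := by
    rw [show (fun p : Plane × Plane => boundaryPotential Lbar R (square p.1 s) p.2) = fun p =>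
      boundaryPotential Lbar R (square 0 s) (p.2 - p.1) from
      funext fun p => boundaryPotential_square Lbar R s p.1 p.2]
    exact (measurable_boundaryPotential Lbar R _ (isClosed_square 0 s).measurableSet).comp
      (measurable_snd.sub measurable_fst)
  have h1 := ((((hl.mul hD2).add ((hf2.mul hg).const_mul (-Complex.I))).enorm.pow_const
    2).lintegral_prod_right').const_mul 2⁻¹
  have h2 := ((hV2.add hb.aemeasurable).mul ((hf2.mul hl).enorm.pow_const 2)).lintegral_prod_right'
  exact h1.add h2

/-- The pointwise bounds depend on `z` only through Gaussians in `x - z`. Tonelli allows integrating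
these first, which gives the masses `π/β` and `π/(β/2)`. -/
lemma lintegral_localizedEnergy_le {Lbar R β s : ℝ} (hL : 0 < Lbar) (hβ : 0 < β)
    (hβL : β < 1 / (2 * Lbar ^ 2)) (hs : 0 < s) (hβs : 128 ≤ β * s ^ 2)
    (hsL : Lbar ≤ 1000 ∨ 24 * Lbar ^ 2 ≤ s) {θ : Plane → ℝ} (hθ : IsCutoff s θ)
    {V : Plane → ℝ≥0∞} (hV : AEMeasurable V volume) {f D : Plane → ℂ}
    (hf : AEStronglyMeasurable f volume) (hD : AEStronglyMeasurable D volume) :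
    ∫⁻ z, localizedEnergy Lbar R s β θ V f D z ≤
      ENNReal.ofReal (1 * (Real.pi / β)) * ((∫⁻ x, ‖D x‖ₑ ^ 2) + potentialEnergy V f) +
      ENNReal.ofReal (65 / s ^ 2 * Real.exp (-(β * s ^ 2 / 8)) * (Real.pi / (β / 2))) *
        ∫⁻ x, ‖f x‖ₑ ^ 2 := by
  let h : Plane → ℝ≥0∞ := fun y => ENNReal.ofReal (1 * Real.exp (-β * ‖y‖ ^ 2))
  let k : ℝ → Plane → ℝ≥0∞ := fun a y => ENNReal.ofReal (a / s ^ 2 * Real.exp (-(β * s ^ 2 / 8)) *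
    Real.exp (-(β / 2) * ‖y‖ ^ 2))
  let G : Plane → Plane → ℝ≥0∞ := fun z x =>
    h (x - z) * (‖D x‖ₑ ^ 2 + V x * ‖f x‖ₑ ^ 2) + k 65 (x - z) * ‖f x‖ₑ ^ 2
  have hDm : AEMeasurable (fun x => ‖D x‖ₑ ^ 2) volume := hD.enorm.pow_const 2
  have hfm : AEMeasurable (fun x => ‖f x‖ₑ ^ 2) volume := hf.enorm.pow_const 2
  have hDV : AEMeasurable (fun x => ‖D x‖ₑ ^ 2 + V x * ‖f x‖ₑ ^ 2) volume :=
    hDm.add (hV.mul hfm)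
  have hle : ∀ z, localizedEnergy Lbar R s β θ V f D z ≤ ∫⁻ x, G z x := fun z => by
    rw [localizedEnergy, ← lintegral_const_mul' _ _ (by simp)]
    -- Superadditivity of the lower integral needs no measurability in `x`.
    refine (le_lintegral_add _ _).trans (lintegral_mono fun x => ?_)
    refine (add_le_add (half_mul_enorm_localized_le hβ hθ z x (D x) (f x))
      (potential_mul_enorm_localized_le (R := R) hL hβ hβL hs hβs hsL hθ z x (V x) (f x))).trans
      (le_of_eq ?_)
    -- `64` comes from the cutoff and `1` from the boundary potential.
    have hk : k 65 (x - z) = k 64 (x - z) + k 1 (x - z) := by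
      simp only [k]
      rw [← ENNReal.ofReal_add (by positivity) (by positivity)]
      congr 1
      ring
    simp only [G, hk]
    simp only [h, k]
    ring
  have hh : Continuous fun p : Plane × Plane => h (p.2 - p.1) := by
    exact ENNReal.continuous_ofReal.comp (by fun_prop)
  have hk : Continuous fun p : Plane × Plane => k 65 (p.2 - p.1) := by
    exact ENNReal.continuous_ofReal.comp (by fun_prop)
  have hG : AEMeasurable (Function.uncurry G) (volume.prod volume) := by
    have hf2 : AEMeasurable (fun p : Plane × Plane => ‖f p.2‖ₑ ^ 2) (volume.prod volume) :=
      hfm.comp_snd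
    have hDV2 : AEMeasurable (fun p : Plane × Plane => ‖D p.2‖ₑ ^ 2 + V p.2 * ‖f p.2‖ₑ ^ 2)
      (volume.prod volume) := hDV.comp_snd
    exact (hh.measurable.aemeasurable.mul hDV2).add (hk.measurable.aemeasurable.mul hf2)
  refine (lintegral_mono hle).trans ?_
  rw [lintegral_lintegral_swap hG]
  have hinner : ∀ x, ∫⁻ z, G z x =
      ENNReal.ofReal (1 * (Real.pi / β)) * (‖D x‖ₑ ^ 2 + V x * ‖f x‖ₑ ^ 2) +
      ENNReal.ofReal (65 / s ^ 2 * Real.exp (-(β * s ^ 2 / 8)) * (Real.pi / (β / 2))) *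
        ‖f x‖ₑ ^ 2 := fun x => by
    have m1 : Measurable fun z => h (x - z) :=
      (hh.comp (by fun_prop : Continuous fun z : Plane => (z, x))).measurable
    have m2 : Measurable fun z => k 65 (x - z) :=
      (hk.comp (by fun_prop : Continuous fun z : Plane => (z, x))).measurable
    simp only [G]
    rw [lintegral_add_left (m1.mul_const _), lintegral_mul_const _ m1, lintegral_mul_const _ m2]
    simp only [h, k]
    rw [lintegral_gaussian_sub hβ zero_le_one, lintegral_gaussian_sub (half_pos hβ) (by positivity)]
  simp only [hinner]
  rw [lintegral_add_left' (hDV.const_mul _), lintegral_const_mul'' _ hDV,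
    lintegral_const_mul'' _ hfm, lintegral_add_left' hDm]
  rfl

lemma potentialEnergy_mul_lt_top {V W : Plane → ℝ≥0∞} {f η : Plane → ℂ} {Q : Set Plane}
    {g : Fin 2 → Plane → ℂ} (h : HasH10Gradient Q f g)
    (hVf : potentialEnergy V f < ∞) (hW : ∀ x, W x ≤ 1) (hη : ∀ x, ‖η x‖ ≤ 1) :
    potentialEnergy (fun x => V x + W x) (fun x => f x * η x) < ∞ := by
  have hfm : AEMeasurable (fun x => ‖f x‖ₑ ^ 2) volume := h.memLp.1.enorm.pow_const 2
  have hle : potentialEnergy (fun x => V x + W x) (fun x => f x * η x) ≤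
      ∫⁻ x, (V x * ‖f x‖ₑ ^ 2 + ‖f x‖ₑ ^ 2) := by
    refine lintegral_mono fun x => ?_
    have h1 : ‖f x * η x‖ₑ ≤ ‖f x‖ₑ := by
      rw [← ofReal_norm, ← ofReal_norm, norm_mul]
      exact ENNReal.ofReal_le_ofReal (mul_le_of_le_one_right (norm_nonneg _) (hη x))
    calc (V x + W x) * ‖f x * η x‖ₑ ^ 2 ≤ (V x + 1) * ‖f x‖ₑ ^ 2 := by gcongr; exact hW x
      _ = _ := by rw [add_mul, one_mul]
  refine hle.trans_lt ?_
  rw [lintegral_add_right' _ hfm]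
  exact ENNReal.add_lt_top.2 ⟨hVf, h.memLp.lintegral_enorm_sq_ne_top.lt_top⟩

lemma norm_localizer_le_one {s β : ℝ} (hβ : 0 < β) {θ : Plane → ℝ} (hθ : IsCutoff s θ)
    (z x : Plane) : ‖localizer β θ z x‖ ≤ 1 := by
  have h := (sq_norm_localizer_le hθ β z x).trans
    (Real.exp_le_one_iff.2 (neg_nonpos.2 (by positivity)))
  exact (sq_le_one_iff₀ (norm_nonneg _)).1 h

/-- The localized functions are in the form domain, and their energy is `localizedEnergy`. -/
lemma HasH10Gradient.localized {Lbar R s m B β : ℝ} (hs : 0 < s) (hβ : 0 < β) {θ : Plane → ℝ}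
    (hθ : IsCutoff s θ) {V : Plane → ℝ≥0∞} {f : Plane → ℂ}
    {g : Fin 2 → Plane → ℂ} (h : HasH10Gradient (square 0 m) f g) (hVf : potentialEnergy V f < ∞)
    (z : Plane) :
    InFormDomain (square z s) (fun x => V x + boundaryPotential Lbar R (square z s) x)
      (fun x => f x * localizer β θ z x) ∧
    schrodingerForm (B + 2 * β) (fun x => V x + boundaryPotential Lbar R (square z s) x)
      (fun x => f x * localizer β θ z x) =
      (localizedEnergy Lbar R s β θ V f (landauLowering B f g) z).toReal := by
  have hsub := tsupport_localizer_subset hθ β z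
  have hl := h.mul (Q' := square z s) (contDiff_localizer hθ β z)
    ((isCompact_square z (3 * s / 4)).of_isClosed_subset (isClosed_tsupport _) hsub)
    (hsub.trans (square_subset_interior z (by linarith)))
  have hpe := potentialEnergy_mul_lt_top h hVf
    (boundaryPotential_le_one Lbar R (square z s)) (norm_localizer_le_one hβ hθ z)
  refine ⟨⟨hl.isH10, hpe⟩, ?_⟩
  rw [hl.schrodingerForm_eq (isCompact_square z s).isBounded (isCompact_square z s).measurableSet _
    hpe.ne, localizedEnergy]
  simp only [landauLowering_mul_localizer hθ]

end

/-! ### The localization estimate -/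

theorem proposition2p2 (Lbar : ℝ) (hLbar : 0 < Lbar) :
    ∃ R₀ : ℝ, 1 ≤ R₀ ∧ (Lbar ≤ 1000 → R₀ = 1) ∧
      ∀ R s : ℝ, R₀ ≤ R → 4 * R ≤ s →
      ∃ θ : Plane → ℝ, IsCutoff s θ ∧
      ∀ B β m : ℝ, 0 < B → 0 < β → β < B / 2 → s ≤ m →
        β < 1 / (2 * Lbar ^ 2) → 128 ≤ β * s ^ 2 →
      ∀ V0 : Plane → ℝ, (∀ x, 0 ≤ V0 x) →
        (∀ K : Set Plane, IsCompact K → MemLp V0 2 (volume.restrict K)) →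
      ∀ (ι : Type) [Countable ι] (ω : ι → Plane),
        LocallySquareIntegrable (impurityPotential V0 ω) →
        (∀ z, tsupport (localizer β θ z) ⊆ square z s) ∧
        ∀ f : Plane → ℂ, IsH10 (square 0 m) f →
          InFormDomain (square 0 m) (impurityPotential V0 ω) f ∧
          (∀ z, InFormDomain (square z s)
            (fun x => impurityPotential V0 ω x + boundaryPotential Lbar R (square z s) x)
            (fun x => f x * localizer β θ z x)) ∧
          IntegrableOn (fun z => schrodingerForm (B + 2 * β)
            (fun x => impurityPotential V0 ω x + boundaryPotential Lbar R (square z s) x)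
            (fun x => f x * localizer β θ z x)) (square 0 (m + s)) volume ∧
          schrodingerForm B (impurityPotential V0 ω) f ≥
            β / (2 * Real.pi) * (∫ z in square 0 (m + s), schrodingerForm (B + 2 * β)
              (fun x => impurityPotential V0 ω x + boundaryPotential Lbar R (square z s) x)
              (fun x => f x * localizer β θ z x)) -
            65 / s ^ 2 * Real.exp (-(β * s ^ 2 / 8)) * ∫ x in square 0 m, ‖f x‖ ^ 2 := by
  -- With `s ≥ 4R`, the value `6 Lbar²` yields the condition `24 Lbar² ≤ s` of `exp_boundary_le`.
  refine ⟨if Lbar ≤ 1000 then 1 else 6 * Lbar ^ 2, ?_, fun h => if_pos h, fun R s hR hRs => ?_⟩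
  · split_ifs with h
    · exact le_rfl
    · nlinarith
  have hs : 0 < s := by
    split_ifs at hR <;> nlinarith
  have hsL : Lbar ≤ 1000 ∨ 24 * Lbar ^ 2 ≤ s := by
    split_ifs at hR with h
    · exact Or.inl h
    · exact Or.inr (by linarith)
  obtain ⟨θ, hθ⟩ := exists_isCutoff hs
  refine ⟨θ, hθ, fun B β m _ hβ _ _ hβL hβs V0 _ hV0 ι _ ω hW => ⟨fun z =>
    (tsupport_localizer_subset hθ β z).trans
      ((square_subset_interior z (by linarith)).trans interior_subset), fun f hf => ?_⟩⟩
  have hV := aemeasurable_impurityPotential hV0 ω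
  generalize impurityPotential V0 ω = V at hW hV ⊢
  have h := hf.hasH10Gradient
  have hQ := isCompact_square 0 m
  have hVf := hW.potentialEnergy_lt_top hV hQ h
  have hloc := h.localized (Lbar := Lbar) (R := R) (B := B) hs hβ hθ hVf
  have hDm := memLp_landauLowering hQ.isBounded hQ.measurableSet h B
  have hform := h.schrodingerForm_eq hQ.isBounded hQ.measurableSet B hVf.ne
  generalize landauLowering B f (fun j => weakPartial j f) = D at hloc hDm hform
  have hFm := aemeasurable_localizedEnergy Lbar R β hθ hV h.memLp.1 hDm.1
  -- The localized energy is nonnegative, so the domain of `z` may be enlarged to the whole plane.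
  have hF := (lintegral_mono' (Measure.restrict_le_self (s := square 0 (m + s))) le_rfl).trans
    (lintegral_localizedEnergy_le (R := R) hLbar hβ hβL hs hβs hsL hθ hV h.memLp.1 hDm.1)
  have hDV : (∫⁻ x, ‖D x‖ₑ ^ 2) + potentialEnergy V f ≠ ∞ :=
    ENNReal.add_ne_top.2 ⟨hDm.lintegral_enorm_sq_ne_top, hVf.ne⟩
  have hfin1 := ENNReal.mul_ne_top
    (ENNReal.ofReal_ne_top (r := 1 * (Real.pi / β))) hDV
  have hfin2 := ENNReal.mul_ne_top (ENNReal.ofReal_ne_top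
    (r := 65 / s ^ 2 * Real.exp (-(β * s ^ 2 / 8)) * (Real.pi / (β / 2))))
    h.memLp.lintegral_enorm_sq_ne_top
  have hfin := ENNReal.add_ne_top.2 ⟨hfin1, hfin2⟩
  refine ⟨⟨hf, hVf⟩, fun z => (hloc z).1, ?_, ?_⟩
  · simp only [(hloc _).2]
    exact integrable_toReal_of_lintegral_ne_top hFm.restrict (ne_top_of_le_ne_top hfin hF)
  · have hle : ∫ z in square 0 (m + s), (localizedEnergy Lbar R s β θ V f D z).toReal ≤
        Real.pi / β * ((∫⁻ x, ‖D x‖ₑ ^ 2).toReal + (potentialEnergy V f).toReal) +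
        65 / s ^ 2 * Real.exp (-(β * s ^ 2 / 8)) * (Real.pi / (β / 2)) * ∫ x, ‖f x‖ ^ 2 := by
      rw [integral_toReal hFm.restrict
        (ae_lt_top' hFm.restrict (ne_top_of_le_ne_top hfin hF))]
      refine (ENNReal.toReal_mono hfin hF).trans (le_of_eq ?_)
      rw [ENNReal.toReal_add hfin1 hfin2, ENNReal.toReal_mul, ENNReal.toReal_mul,
        ENNReal.toReal_add hDm.lintegral_enorm_sq_ne_top hVf.ne,
        ← integral_sq_norm_eq_toReal_lintegral h.memLp.1, ENNReal.toReal_ofReal (by positivity),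
        ENNReal.toReal_ofReal (by positivity), one_mul]
    have hfQ : ∫ x in square 0 m, ‖f x‖ ^ 2 = ∫ x, ‖f x‖ ^ 2 := by
      refine setIntegral_eq_integral_of_ae_compl_eq_zero ?_
      filter_upwards [h.ae_eq_zero hQ.measurableSet] with x hx hxQ
      simp [hx hxQ]
    simp only [(hloc _).2]
    rw [hfQ, hform, ENNReal.toReal_add (ENNReal.mul_ne_top (by simp)
      hDm.lintegral_enorm_sq_ne_top) hVf.ne, ENNReal.toReal_mul]
    have hπ := Real.pi_pos
    have h1 := mul_le_mul_of_nonneg_left hle (by positivity : 0 ≤ β / (2 * Real.pi))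
    -- After the prefactor the kinetic term `a/2` matches exactly, the potential term `p/2` leaves
    -- room since `p ≥ 0`, and the error keeps the constant `65`.
    have h2 : ∀ a p e : ℝ, β / (2 * Real.pi) * (Real.pi / β * (a + p) +
        65 / s ^ 2 * Real.exp (-(β * s ^ 2 / 8)) * (Real.pi / (β / 2)) * e) =
        (a + p) / 2 + 65 / s ^ 2 * Real.exp (-(β * s ^ 2 / 8)) * e := fun a p e => by
      field_simp
    rw [h2] at h1
    have h3 : 0 ≤ (potentialEnergy V f).toReal := ENNReal.toReal_nonneg
    simp only [ENNReal.toReal_inv, ENNReal.toReal_ofNat]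
    linarith
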